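/- **Setting.** A \emph{system} consists of a finite-dimensional real vector space $A$; a non-empty compact convex set $\Omega\subset A$ of (normalized) states that spans $A$, together with a linear functional $u$ on $A$ with $u(\omega)=1$ for all $\omega\in\Omega$; a set $\mathcal E$ of allowed effects; and a set of allowed transformations. Write $A_+=\{\lambda\omega:\lambda\ge 0,\ \omega\in\Omega\}$ and $A_+^*=\{f\in A^*: f\ge 0\text{ on }A_+\}$. An \emph{effect} is a linear functional $e$ with $0\le e\le 1$ on $\Omega$. The set $\mathcal E$ is a closed convex set of effects that spans $A^*$, contains $u$, contains $u-e$ whenever $e\in\mathcal E$, and contains $e+f$ whenever $e,f\in\mathcal E$ and $e+f$ is an effect. The allowed transformations form a closed set, closed under composition, of linear maps $T:A\to A$ with $T(A_+)\subseteq A_+$, $u(T\omega)\le 1$ for $\omega\in\Omega$, and $e\circ T\in\mathcal E$ for all $e\in\mathcal E$. $T$ is \emph{reversible} if $T$ is allowed and has an inverse that is allowed. \emph{Pure} states are the extreme points of $\Omega$; other states are \emph{mixed}. An \emph{$n$-frame} is a list $\omega_1,\dots,\omega_n$ of pure states for which there are $e_1,\dots,e_n\in\mathcal E$ with $\sum_i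 e_i\le u$ on $\Omega$ and $e_i(\omega_j)=\delta_{ij}$. *Postulate 1.* Every $\omega\in\Omega$ is of the form $\omega=\sum_{i=1}^n p_i\omega_i$ with $p_i\ge0$, $\sum_i p_i=1$, for some $n$ and some $n$-frame $\omega_1,\dots,\omega_n$. *Postulate 2.* If $\omega_1,\dots,\omega_n$ and $\varphi_1,\dots,\varphi_n$ are $n$-frames, there is a reversible $T$ with $T\omega_i=\varphi_i$ for all $i$. **Inner product.** Call an inner product $\langle\cdot,\cdot\rangle$ on $A$ \emph{admissible} if $A_+=\{y:\langle y,x\rangle\ge 0\ \forall x\in A_+\}$, every reversible transformation is orthogonal, and $\|\omega\|=1$ for every pure state $\omega$ and $\|\omega\|<1$ for every mixed state $\omega$. **Third-order interference** (relative to an admissible inner product). A face of $A_+$ is a non-empty convex extreme subset of $A_+$. For a face $F$ put $F'=F^\perp\cap A_+$. Let $F_1,\dots,F_M$ be faces of $A_+$ with $F_i\perp F_j$ for $i\ne j$, and for $J\subseteq\{1,\dots,M\}$ let $F_J=\bigvee_{j\in J}F_j$ be the smallest face containing all $F_j$, $j\in J$. Together with effects $(e_J)_{J\subseteq\{1,\dots,M\}}$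 they form an \emph{$M$-slit experiment} if there is an effect $e$ such that, for all $J$, $e_J(\omega)=e(\omega)$ for $\omega\in F_J$ and $e_J(\varphi)=0$ for $\varphi\in F_J'$. The system has \emph{third-order interference} if for some $M\ge3$ there are an $M$-slit experiment and a state $\omega\in\Omega$ with $$e_{12\cdots M}(\omega)\ne\sum_{i<j}e_{ij}(\omega)-(M-2)\sum_i e_i(\omega).$$ **Filters.** For a finite-dimensional real vector space $V$ with a cone $V_+$, a linear map $P:V\to V$ with $P^2=P$ and $P(V_+)\subseteq V_+$ is called a positive projection; it is \emph{complemented} if there is a positive projection $Q$ with $\operatorname{im}P\cap V_+=\ker Q\cap V_+$ and $\operatorname{im}Q\cap V_+=\ker P\cap V_+$. A \emph{filter} is a positive projection $P$ on $(A,A_+)$ that is complemented, whose dual $P^*$ on $(A^*,A_+^*)$ is complemented, and which satisfies $u(P\omega)\le u(\omega)$ for all $\omega\in A_+$. It is \emph{purity-preserving} if for every pure state $\omega$, $P\omega$ is a nonnegative multiple of a pure state. **Proposition.** Let a system satisfy Postulates 1 and 2. Then it has an admissible inner product, and with respect to any admissible inner product, the system has no third-order interference if and only if all its filters are purity-preserving.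 -/

import Mathlib

namespace OPT

/-- The set of nonnegative multiples of elements of `Ω`. -/
def coneOver {A : Type*} [AddCommGroup A] [Module ℝ A] (Ω : Set A) : Set A :=
  {x | ∃ r : ℝ, 0 ≤ r ∧ ∃ ω ∈ Ω, x = r • ω}

/-- A (mathematically valid) effect: a functional with values in `[0, 1]` on the states `Ω`. -/
def IsEffectOn {A : Type*} [NormedAddCommGroup A] [NormedSpace ℝ A] (Ω : Set A)
    (e : A →L[ℝ] ℝ) : Prop :=
  ∀ ω ∈ Ω, 0 ≤ e ω ∧ e ω ≤ 1

/-- A finite-dimensional system of the operational probabilistic framework: normalized states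
forming a compact convex set which lies in an affine hyperplane off the origin and spans the
space, allowed effects, and allowed transformations. The norm of `A` is only used for the topology
(all norms on a finite-dimensional space are equivalent). -/
structure OpSystem (A : Type*) [NormedAddCommGroup A] [NormedSpace ℝ A]
    [FiniteDimensional ℝ A] where
  /-- the normalized states -/
  states : Set A
  states_nonempty : states.Nonempty
  states_convex : Convex ℝ states
  states_compact : IsCompact states
  states_span : Submodule.span ℝ states = ⊤
  /-- the unit functional `u` -/
  unit : A →L[ℝ] ℝ
  unit_eq_one : ∀ ω ∈ states, unit ω = 1
  /-- the allowed effects -/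
  allowed : Set (A →L[ℝ] ℝ)
  allowed_effect : ∀ e ∈ allowed, IsEffectOn states e
  allowed_convex : Convex ℝ allowed
  allowed_closed : IsClosed allowed
  allowed_span : Submodule.span ℝ allowed = ⊤
  unit_allowed : unit ∈ allowed
  compl_allowed : ∀ e ∈ allowed, unit - e ∈ allowed
  add_allowed : ∀ e ∈ allowed, ∀ f ∈ allowed, IsEffectOn states (e + f) → e + f ∈ allowed
  /-- the allowed transformations -/
  transformations : Set (A →L[ℝ] A)
  transformations_positive :
    ∀ T ∈ transformations, ∀ x ∈ coneOver states, T x ∈ coneOver states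
  transformations_normalized : ∀ T ∈ transformations, ∀ ω ∈ states, unit (T ω) ≤ 1
  transformations_closed : IsClosed transformations
  transformations_comp : ∀ T ∈ transformations, ∀ T' ∈ transformations, T.comp T' ∈ transformations
  transformations_effects : ∀ T ∈ transformations, ∀ e ∈ allowed, e.comp T ∈ allowed

/-- `P` is a positive projection with respect to the cone `K`. -/
def IsPosProj {V : Type*} [AddCommGroup V] [Module ℝ V] (K : Set V) (P : V →ₗ[ℝ] V) : Prop :=
  P ∘ₗ P = P ∧ ∀ x ∈ K, P x ∈ K

/-- `P` is complemented with respect to the cone `K`: there is a positive projection `Q` with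
`im P ∩ K = ker Q ∩ K` and `im Q ∩ K = ker P ∩ K`. -/
def IsComplemented {V : Type*} [AddCommGroup V] [Module ℝ V] (K : Set V)
    (P : V →ₗ[ℝ] V) : Prop :=
  ∃ Q : V →ₗ[ℝ] V, IsPosProj K Q ∧
    (LinearMap.range P : Set V) ∩ K = (LinearMap.ker Q : Set V) ∩ K ∧
    (LinearMap.range Q : Set V) ∩ K = (LinearMap.ker P : Set V) ∩ K

namespace OpSystem

variable {A : Type*} [NormedAddCommGroup A] [NormedSpace ℝ A] [FiniteDimensional ℝ A]

/-- The cone `A₊` of unnormalized states. -/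
def cone (S : OpSystem A) : Set A := coneOver S.states

/-- The dual cone of functionals that are nonnegative on `A₊`. -/
def dualCone (S : OpSystem A) : Set (Module.Dual ℝ A) := {f | ∀ x ∈ S.cone, 0 ≤ f x}

/-- Pure states are the extreme points of the set of normalized states. -/
def IsPure (S : OpSystem A) (ω : A) : Prop := ω ∈ Set.extremePoints ℝ S.states

/-- Effects: the functionals `e` with `0 ≤ e ≤ u`. -/
def IsEffect (S : OpSystem A) (e : A →L[ℝ] ℝ) : Prop := IsEffectOn S.states e

/-- A transformation is reversible if it is allowed and has an allowed inverse. -/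
def IsReversible (S : OpSystem A) (T : A →L[ℝ] A) : Prop :=
  T ∈ S.transformations ∧ ∃ T' ∈ S.transformations,
    T.comp T' = ContinuousLinearMap.id ℝ A ∧ T'.comp T = ContinuousLinearMap.id ℝ A

/-- Perfect distinguishability by allowed effects `e i` with `∑ i, e i ≤ u`. -/
def PerfectlyDistinguishable (S : OpSystem A) {n : ℕ} (w : Fin n → A) : Prop :=
  ∃ e : Fin n → (A →L[ℝ] ℝ), (∀ i, e i ∈ S.allowed) ∧
    (∀ ω ∈ S.states, ∑ i, e i ω ≤ S.unit ω) ∧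
    ∀ i j, e i (w j) = if i = j then 1 else 0

/-- An `n`-frame: a list of `n` perfectly distinguishable pure states. -/
def IsFrame (S : OpSystem A) {n : ℕ} (w : Fin n → A) : Prop :=
  (∀ i, S.IsPure (w i)) ∧ S.PerfectlyDistinguishable w

/-- Every state is a convex combination of the elements of some frame. -/
def Postulate1 (S : OpSystem A) : Prop :=
  ∀ ω ∈ S.states, ∃ (n : ℕ) (w : Fin n → A) (p : Fin n → ℝ),
    S.IsFrame w ∧ (∀ i, 0 ≤ p i) ∧ ∑ i, p i = 1 ∧ ω = ∑ i, p i • w i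

/-- Any two frames of the same size are related by a reversible transformation. -/
def Postulate2 (S : OpSystem A) : Prop :=
  ∀ (n : ℕ) (w v : Fin n → A), S.IsFrame w → S.IsFrame v →
    ∃ T : A →L[ℝ] A, S.IsReversible T ∧ ∀ i, T (w i) = v i

/-- The inner products used to identify `A` with its dual: self-dualizing, invariant under the
reversible transformations, with norm `1` at pure states and norm `< 1` at mixed states. -/
structure IsSelfDualizing (S : OpSystem A) (B : LinearMap.BilinForm ℝ A) : Prop where
  symm : ∀ x y, B x y = B y x
  pos : ∀ x, x ≠ 0 → 0 < B x x
  selfDual : {y | ∀ x ∈ S.cone, 0 ≤ B y x} = S.cone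
  invariant : ∀ T, S.IsReversible T → ∀ x y, B (T x) (T y) = B x y
  pure_norm : ∀ ω, S.IsPure ω → Real.sqrt (B ω ω) = 1
  mixed_norm : ∀ ω ∈ S.states, ¬ S.IsPure ω → Real.sqrt (B ω ω) < 1

/-- Faces of the cone `A₊` (the empty set is not counted as a face of `A₊`). -/
def IsFace (S : OpSystem A) (F : Set A) : Prop :=
  F.Nonempty ∧ Convex ℝ F ∧ IsExtreme ℝ S.cone F

/-- The smallest face of `A₊` which contains `X`. -/
def faceGen (S : OpSystem A) (X : Set A) : Set A := ⋂₀ {G | S.IsFace G ∧ X ⊆ G}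

/-- The face `F_J`, the join of the faces `F j` with `j ∈ J`. -/
def faceJoin (S : OpSystem A) {M : ℕ} (F : Fin M → Set A) (J : Finset (Fin M)) : Set A :=
  S.faceGen (⋃ j ∈ J, F j)

/-- The set `F' = Fᗮ ∩ A₊` relative to the inner product `B`. -/
def complFace (S : OpSystem A) (B : LinearMap.BilinForm ℝ A) (F : Set A) : Set A :=
  {φ ∈ S.cone | ∀ x ∈ F, B x φ = 0}

/-- `M`-slit experiments, with slit faces `F j` and effects `e J` for the sets `J` of open
slits. -/
structure IsSlitExperiment (S : OpSystem A) (B : LinearMap.BilinForm ℝ A) {M : ℕ}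
    (F : Fin M → Set A) (e : Finset (Fin M) → (A →L[ℝ] ℝ)) : Prop where
  face : ∀ j, S.IsFace (F j)
  orthogonal : ∀ i j, i ≠ j → ∀ x ∈ F i, ∀ y ∈ F j, B x y = 0
  effect : ∀ J, S.IsEffect (e J)
  exists_effect : ∃ e₀ : A →L[ℝ] ℝ, S.IsEffect e₀ ∧ ∀ J,
    (∀ ω ∈ S.faceJoin F J, e J ω = e₀ ω) ∧
    (∀ φ ∈ S.complFace B (S.faceJoin F J), e J φ = 0)

/-- The system exhibits third-order interference. -/
def HasThirdOrderInterference (S : OpSystem A) (B : LinearMap.BilinForm ℝ A) : Prop :=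
  ∃ (M : ℕ) (F : Fin M → Set A) (e : Finset (Fin M) → (A →L[ℝ] ℝ)),
    3 ≤ M ∧ S.IsSlitExperiment B F e ∧ ∃ ω ∈ S.states,
      e Finset.univ ω ≠
        (∑ i, ∑ j ∈ Finset.Ioi i, e {i, j} ω) - ((M : ℝ) - 2) * ∑ i, e {i} ω

/-- A filter: a positive projection which is complemented, whose dual is complemented, and which
does not increase `u` on `A₊`. -/
structure IsFilter (S : OpSystem A) (P : A →ₗ[ℝ] A) : Prop where
  posProj : IsPosProj S.cone P
  complemented : IsComplemented S.cone P
  dual_complemented : IsComplemented S.dualCone P.dualMap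
  normalized : ∀ ω ∈ S.cone, S.unit (P ω) ≤ S.unit ω

/-- `P` maps pure states to nonnegative multiples of pure states. -/
def PreservesPurity (S : OpSystem A) (P : A →ₗ[ℝ] A) : Prop :=
  ∀ ω, S.IsPure ω → ∃ (r : ℝ) (σ : A), 0 ≤ r ∧ S.IsPure σ ∧ P ω = r • σ

end OpSystem

end OPT

namespace OPT
namespace OpSystem

variable {A : Type*} [NormedAddCommGroup A] [NormedSpace ℝ A] [FiniteDimensional ℝ A]

/-! ### The cone of a system -/

/-! Averaging over the compact group of reversible maps gives an invariant inner product. It has a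
constant value `a` on the pairs `(ω, ω)` with `ω` pure and, by Postulate 2 for 2-frames, a constant
value `c` on pairs of distinct members of a frame. Subtracting `c • u ⊗ u` and rescaling makes all
maximal frames orthonormal. Since every vector is a combination of a maximal frame, the resulting
form is self-dualizing. Conversely, self-duality and normalization force `c = 0` for every
admissible form (`IsSelfDualizing.isFrameForm`). From then on only a spectral calculus is used
(`IsSpectral`): cone elements are positive combinations of orthogonal pure states, and orthogonal
families extend to ones with sum `I`, the representative of `u`.

Every face consists of the `x` in the cone with `⟨x, p⟩ = u x`, where `p` is a sum of orthogonal
pure states (`exists_eq_projFace`). The orthogonal projection `P_p` onto its span is positive, and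
the filters are exactly these projections (`isFilter_proj`, `exists_eq_proj_of_isFilter`). In a slit
experiment `e_J = e ∘ P_J` (`effect_eq_proj`), so absence of interference amounts to `P_{1…M} =
∑_{i<j} P_{ij} - (M - 2) ∑ P_i`.

Both directions rest on `∑_{i<j} (l_i + l_j)² - (M - 2) ∑ l_i² = (∑ l_i)²` and on `‖y‖ ≤ u y` in the
cone, with equality for multiples of pure states. If filters preserve purity, then `‖P_J σ‖² =
(∑_{k∈J} ⟨σ, p_k⟩)²` for pure `σ`. The identity then shows that the right-hand side `R` of the
operator equation satisfies `⟨σ, Rσ⟩ = ‖Rσ‖² = 1` for `σ` in the joint face, so `Rσ = σ`.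
Conversely, without interference the effect `⟨ω, ·⟩` tested on the pure state `ω` itself forces
`‖P_{ij} ω‖ = u (P_{ij} ω)` for all pairs of a maximal frame. A projection `P_p ω` with two nonzero
spectral components would violate this for a frame containing those components. -/

theorem mem_cone_of_mem_states (S : OpSystem A) {ω : A} (h : ω ∈ S.states) : ω ∈ S.cone :=
  ⟨1, zero_le_one, ω, h, (one_smul _ _).symm⟩

theorem IsPure.mem_states {S : OpSystem A} {ω : A} (h : S.IsPure ω) : ω ∈ S.states := h.1

theorem IsPure.mem_cone {S : OpSystem A} {ω : A} (h : S.IsPure ω) : ω ∈ S.cone :=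
  S.mem_cone_of_mem_states h.mem_states

theorem IsPure.unit_eq {S : OpSystem A} {ω : A} (h : S.IsPure ω) : S.unit ω = 1 :=
  S.unit_eq_one ω h.mem_states

theorem zero_mem_cone (S : OpSystem A) : (0 : A) ∈ S.cone := by
  obtain ⟨ω, h⟩ := S.states_nonempty
  exact ⟨0, le_rfl, ω, h, (zero_smul _ _).symm⟩

theorem smul_mem_cone (S : OpSystem A) {r : ℝ} (hr : 0 ≤ r) {x : A} (hx : x ∈ S.cone) :
    r • x ∈ S.cone := by
  obtain ⟨t, ht, ω, h, rfl⟩ := hx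
  exact ⟨r * t, mul_nonneg hr ht, ω, h, smul_smul _ _ _⟩

theorem add_mem_cone (S : OpSystem A) {x y : A} (hx : x ∈ S.cone) (hy : y ∈ S.cone) :
    x + y ∈ S.cone := by
  obtain ⟨r, hr, ω, h, rfl⟩ := hx
  obtain ⟨t, ht, φ, h', rfl⟩ := hy
  rcases eq_or_lt_of_le (add_nonneg hr ht) with h0 | h0
  · have hr0 : r = 0 := by linarith
    have ht0 : t = 0 := by linarith
    subst hr0 ht0
    simpa using S.zero_mem_cone
  · refine ⟨r + t, h0.le, (r / (r + t)) • ω + (t / (r + t)) • φ,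
      S.states_convex h h' (by positivity) (by positivity) (by field_simp), ?_⟩
    rw [smul_add, smul_smul, smul_smul, mul_div_cancel₀ _ h0.ne', mul_div_cancel₀ _ h0.ne']

theorem sum_mem_cone (S : OpSystem A) {ι : Type*} (s : Finset ι) {f : ι → A}
    (h : ∀ i ∈ s, f i ∈ S.cone) : ∑ i ∈ s, f i ∈ S.cone := by
  classical
  induction s using Finset.induction_on with
  | empty => simpa using S.zero_mem_cone
  | insert a s ha ih =>
    rw [Finset.sum_insert ha]
    exact S.add_mem_cone (h a (by simp)) (ih fun i hi => h i (by simp [hi]))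

theorem unit_nonneg (S : OpSystem A) {x : A} (hx : x ∈ S.cone) : 0 ≤ S.unit x := by
  obtain ⟨r, hr, ω, h, rfl⟩ := hx
  simpa [S.unit_eq_one ω h] using hr

theorem exists_eq_unit_smul (S : OpSystem A) {x : A} (hx : x ∈ S.cone) :
    ∃ ω ∈ S.states, x = S.unit x • ω := by
  obtain ⟨r, hr, ω, h, rfl⟩ := hx
  exact ⟨ω, h, by simp [S.unit_eq_one ω h]⟩

theorem eq_zero_of_unit_eq_zero (S : OpSystem A) {x : A} (hx : x ∈ S.cone)
    (h : S.unit x = 0) : x = 0 := by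
  obtain ⟨ω, -, h'⟩ := S.exists_eq_unit_smul hx
  rw [h', h, zero_smul]

theorem mem_states_of_unit_eq_one (S : OpSystem A) {x : A} (hx : x ∈ S.cone)
    (h : S.unit x = 1) : x ∈ S.states := by
  obtain ⟨ω, h1, h'⟩ := S.exists_eq_unit_smul hx
  rw [h', h, one_smul]
  exact h1

theorem span_cone (S : OpSystem A) : Submodule.span ℝ S.cone = ⊤ :=
  top_le_iff.1 (S.states_span ▸ Submodule.span_mono fun _ h => S.mem_cone_of_mem_states h)

theorem linearMap_ext {V : Type*} [AddCommGroup V] [Module ℝ V] (S : OpSystem A)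
    {f g : A →ₗ[ℝ] V} (h : ∀ x ∈ S.states, f x = g x) : f = g :=
  LinearMap.ext_on S.states_span h

/-! ### Allowed effects -/

theorem zero_allowed (S : OpSystem A) : (0 : A →L[ℝ] ℝ) ∈ S.allowed := by
  simpa using S.compl_allowed _ S.unit_allowed

theorem effect_nonneg (S : OpSystem A) {e : A →L[ℝ] ℝ} (he : S.IsEffect e) {x : A}
    (hx : x ∈ S.cone) : 0 ≤ e x := by
  obtain ⟨r, hr, ω, h, rfl⟩ := hx
  simpa using mul_nonneg hr (he ω h).1

theorem allowed_nonneg (S : OpSystem A) {e : A →L[ℝ] ℝ} (he : e ∈ S.allowed) {x : A}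
    (hx : x ∈ S.cone) : 0 ≤ e x :=
  S.effect_nonneg (S.allowed_effect e he) hx

theorem sum_allowed (S : OpSystem A) {ι : Type*} (s : Finset ι) {e : ι → (A →L[ℝ] ℝ)}
    (he : ∀ i ∈ s, e i ∈ S.allowed) (hs : ∀ ω ∈ S.states, ∑ i ∈ s, e i ω ≤ 1) :
    ∑ i ∈ s, e i ∈ S.allowed := by
  classical
  induction s using Finset.induction_on with
  | empty => simpa using S.zero_allowed
  | insert a s ha ih =>
    have hpos : ∀ i ∈ insert a s, ∀ ω ∈ S.states, 0 ≤ e i ω := fun i hi ω hω =>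
      S.allowed_nonneg (he i hi) (S.mem_cone_of_mem_states hω)
    rw [Finset.sum_insert ha]
    refine S.add_allowed _ (he a (by simp)) _ (ih (fun i hi => he i (by simp [hi])) ?_) ?_
    · intro ω hω
      have h1 := hs ω hω
      rw [Finset.sum_insert ha] at h1
      linarith [hpos a (by simp) ω hω]
    · intro ω hω
      have h1 := hs ω hω
      rw [Finset.sum_insert ha] at h1
      simp only [add_apply, sum_apply]
      exact ⟨add_nonneg (hpos a (by simp) ω hω)
        (Finset.sum_nonneg fun i hi => hpos i (by simp [hi]) ω hω), h1⟩

/-! ### Reversible transformations -/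

theorem IsReversible.exists_inv {S : OpSystem A} {T : A →L[ℝ] A} (h : S.IsReversible T) :
    ∃ T', S.IsReversible T' ∧ (∀ x, T (T' x) = x) ∧ ∀ x, T' (T x) = x := by
  obtain ⟨h1, T', h2, h3, h4⟩ := h
  exact ⟨T', ⟨h2, T, h1, h4, h3⟩, fun x => DFunLike.congr_fun h3 x,
    fun x => DFunLike.congr_fun h4 x⟩

theorem IsReversible.mem_cone {S : OpSystem A} {T : A →L[ℝ] A} (h : S.IsReversible T) {x : A}
    (hx : x ∈ S.cone) : T x ∈ S.cone :=
  S.transformations_positive T h.1 x hx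

theorem IsReversible.unit_le {S : OpSystem A} {T : A →L[ℝ] A} (h : S.IsReversible T) {x : A}
    (hx : x ∈ S.cone) : S.unit (T x) ≤ S.unit x := by
  obtain ⟨r, hr, ω, hω, rfl⟩ := hx
  simpa [S.unit_eq_one ω hω] using
    mul_le_mul_of_nonneg_left (S.transformations_normalized T h.1 ω hω) hr

/-- Neither `T` nor its inverse can increase `u` on the cone, so both preserve it there, and the
states span. -/
theorem IsReversible.unit_apply {S : OpSystem A} {T : A →L[ℝ] A} (h : S.IsReversible T)
    (x : A) : S.unit (T x) = S.unit x := by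
  obtain ⟨T', h', -, h2⟩ := h.exists_inv
  have := S.linearMap_ext (f := (S.unit.comp T).toLinearMap) (g := S.unit.toLinearMap)
    fun ω hω => by
      have hc := S.mem_cone_of_mem_states hω
      refine le_antisymm (h.unit_le hc) ?_
      have := h'.unit_le (h.mem_cone hc)
      rwa [h2] at this
  exact DFunLike.congr_fun this x

theorem IsReversible.mem_states {S : OpSystem A} {T : A →L[ℝ] A} (h : S.IsReversible T)
    {ω : A} (hω : ω ∈ S.states) : T ω ∈ S.states :=
  S.mem_states_of_unit_eq_one (h.mem_cone (S.mem_cone_of_mem_states hω))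
    (by rw [h.unit_apply, S.unit_eq_one ω hω])

theorem IsReversible.isPure {S : OpSystem A} {T : A →L[ℝ] A} (h : S.IsReversible T)
    {ω : A} (hω : S.IsPure ω) : S.IsPure (T ω) := by
  obtain ⟨T', h', h1, h2⟩ := h.exists_inv
  refine ⟨h.mem_states hω.1, fun x hx y hy hxy => ?_⟩
  have key : ω ∈ openSegment ℝ (T' x) (T' y) := by
    obtain ⟨a, b, ha, hb, hab, e⟩ := hxy
    exact ⟨a, b, ha, hb, hab, by rw [← h2 ω, ← e]; simp⟩
  rw [← hω.2 (h'.mem_states hx) (h'.mem_states hy) key, h1]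

theorem IsReversible.isFrame {S : OpSystem A} {T : A →L[ℝ] A} (h : S.IsReversible T)
    {n : ℕ} {w : Fin n → A} (hw : S.IsFrame w) : S.IsFrame fun i => T (w i) := by
  obtain ⟨T', h', h1, h2⟩ := h.exists_inv
  obtain ⟨hp, e, he, hs, hd⟩ := hw
  refine ⟨fun i => h.isPure (hp i), fun i => (e i).comp T',
    fun i => S.transformations_effects T' h'.1 _ (he i), fun ω hω => ?_, fun i j => ?_⟩
  · have := hs _ (h'.mem_states hω)
    rwa [h'.unit_apply] at this
  · simp [h2, hd]

/-! ### Frames -/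

theorem IsFrame.comp {S : OpSystem A} {n m : ℕ} {w : Fin n → A} (hw : S.IsFrame w)
    {f : Fin m → Fin n} (hf : Function.Injective f) : S.IsFrame fun i => w (f i) := by
  obtain ⟨hp, e, he, hs, hd⟩ := hw
  refine ⟨fun i => hp _, fun i => e (f i), fun i => he _, fun ω hω => ?_, fun i j => ?_⟩
  · refine le_trans ?_ (hs ω hω)
    rw [← Finset.sum_image (s := Finset.univ) (g := f) (f := fun i => e i ω)
      (fun a _ b _ hab => hf hab)]
    exact Finset.sum_le_sum_of_subset_of_nonneg (Finset.subset_univ _) fun i _ _ =>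
      (S.allowed_effect _ (he i) ω hω).1
  · simp [hd, hf.eq_iff]

theorem isFrame_single {S : OpSystem A} {ω : A} (h : S.IsPure ω) :
    S.IsFrame fun _ : Fin 1 => ω := by
  refine ⟨fun _ => h, fun _ => S.unit, fun _ => S.unit_allowed, fun φ _ => by simp, fun i j => ?_⟩
  simp [h.unit_eq, Subsingleton.elim i j]

theorem IsFrame.pair {S : OpSystem A} {n : ℕ} {w : Fin n → A} (hw : S.IsFrame w)
    {i j : Fin n} (hij : i ≠ j) : S.IsFrame ![w i, w j] := by
  have h := hw.comp (f := ![i, j]) (by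
    intro a b hab
    fin_cases a <;> fin_cases b <;> simp_all [eq_comm])
  convert h using 1
  funext a
  fin_cases a <;> rfl

theorem exists_reversible_of_pure {S : OpSystem A} (h2 : S.Postulate2) {ω φ : A}
    (hω : S.IsPure ω) (hφ : S.IsPure φ) : ∃ T, S.IsReversible T ∧ T ω = φ := by
  obtain ⟨T, hT, h⟩ := h2 1 _ _ (isFrame_single hω) (isFrame_single hφ)
  exact ⟨T, hT, h 0⟩

/-- The identity is not assumed to be allowed. Postulate 2 for the empty frame supplies some
reversible map, and composing it with its inverse gives the identity. -/
theorem isReversible_id {S : OpSystem A} (h2 : S.Postulate2) :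
    S.IsReversible (ContinuousLinearMap.id ℝ A) := by
  have h0 : S.IsFrame (Fin.elim0 : Fin 0 → A) :=
    ⟨fun i => i.elim0, fun i => i.elim0, fun i => i.elim0,
      fun ω hω => by simp [S.unit_eq_one ω hω], fun i => i.elim0⟩
  obtain ⟨T, ⟨hT, T', hT', h, -⟩, -⟩ := h2 0 _ _ h0 h0
  have := S.transformations_comp _ hT _ hT'
  rw [h] at this
  exact ⟨this, _, this, rfl, rfl⟩

/-! ### The compact group of reversible transformations and an invariant inner product -/

theorem IsReversible.comp {S : OpSystem A} {T U : A →L[ℝ] A} (hT : S.IsReversible T)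
    (hU : S.IsReversible U) : S.IsReversible (T.comp U) := by
  obtain ⟨T', hT', h1, h2⟩ := hT.exists_inv
  obtain ⟨U', hU', h3, h4⟩ := hU.exists_inv
  exact ⟨S.transformations_comp _ hT.1 _ hU.1, U'.comp T',
    S.transformations_comp _ hU'.1 _ hT'.1, by ext x; simp [h1, h3], by ext x; simp [h2, h4]⟩

theorem isReversible_unit_iff {S : OpSystem A} (g : (A →L[ℝ] A)ˣ) :
    S.IsReversible (g : A →L[ℝ] A) ↔
      (g : A →L[ℝ] A) ∈ S.transformations ∧ ((g⁻¹ : (A →L[ℝ] A)ˣ) : A →L[ℝ] A) ∈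
        S.transformations := by
  constructor
  · rintro ⟨h1, T', h2, h3, h4⟩
    have : ((g⁻¹ : (A →L[ℝ] A)ˣ) : A →L[ℝ] A) = T' := Units.inv_eq_of_mul_eq_one_right h3
    exact ⟨h1, this ▸ h2⟩
  · rintro ⟨h1, h2⟩
    exact ⟨h1, _, h2, g.mul_inv, g.inv_mul⟩

/-- The reversible transformations as a group of units. -/
def reversibleSubgroup (S : OpSystem A) (h2 : S.Postulate2) : Subgroup (A →L[ℝ] A)ˣ where
  carrier := {g | S.IsReversible (g : A →L[ℝ] A)}
  mul_mem' ha hb := IsReversible.comp ha hb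
  one_mem' := isReversible_id h2
  inv_mem' {g} hg := by
    have := (isReversible_unit_iff g).1 hg
    exact (isReversible_unit_iff g⁻¹).2 ⟨this.2, by simpa using this.1⟩

/-- Boundedness holds because some basis of `A` consists of states, and its images stay in the
bounded set of states. -/
theorem isCompact_statePreserving (S : OpSystem A) :
    IsCompact {T : A →L[ℝ] A | T ∈ S.transformations ∧ ∀ ω ∈ S.states, T ω ∈ S.states} := by
  refine Metric.isCompact_of_isClosed_isBounded ?_ ?_
  · have : {T : A →L[ℝ] A | T ∈ S.transformations ∧ ∀ ω ∈ S.states, T ω ∈ S.states} =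
        S.transformations ∩ ⋂ ω ∈ S.states, (fun T : A →L[ℝ] A => T ω) ⁻¹' S.states := by
      ext T
      simp
    rw [this]
    refine S.transformations_closed.inter (isClosed_biInter fun ω _ => ?_)
    exact S.states_compact.isClosed.preimage (ContinuousLinearMap.apply ℝ A ω).continuous
  · let b := Module.Basis.ofSpan S.states_span.ge
    have hfin : Finite ((linearIndepOn_empty ℝ id).extend (Set.empty_subset S.states) : Set A) :=
      Module.Finite.finite_basis b
    obtain ⟨C, -, hC⟩ := b.exists_opNorm_le (F := A)
    obtain ⟨R, hR⟩ := S.states_compact.isBounded.exists_norm_le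
    refine isBounded_iff_forall_norm_le.2 ⟨C * max R 0, fun T hT => hC (le_max_right _ _) ?_⟩
    intro i
    exact (hR _ (hT.2 _ (Module.Basis.ofSpan_subset S.states_span.ge ⟨i, rfl⟩))).trans
      (le_max_left _ _)

/-- The unit group carries the topology of pairs `(g, g⁻¹)`, so both the map and its inverse have to
be confined to a compact set. -/
theorem compactSpace_reversibleSubgroup (S : OpSystem A) (h2 : S.Postulate2) :
    CompactSpace (S.reversibleSubgroup h2) := by
  refine isCompact_iff_compactSpace.1 ?_
  have hK := S.isCompact_statePreserving
  have hK' := hK.prod (hK.image MulOpposite.continuous_op)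
  convert Units.isClosedEmbedding_embedProduct.isCompact_preimage hK' using 1
  ext g
  constructor
  · intro hg
    have hg' := (S.reversibleSubgroup h2).inv_mem hg
    exact ⟨⟨And.left hg, fun ω hω => IsReversible.mem_states hg hω⟩,
      ⟨_, ⟨hg'.1, fun ω hω => IsReversible.mem_states hg' hω⟩, rfl⟩⟩
  · rintro ⟨h1, T, h3, h4⟩
    refine (isReversible_unit_iff g).2 ⟨h1.1, ?_⟩
    have : T = ((g⁻¹ : (A →L[ℝ] A)ˣ) : A →L[ℝ] A) := MulOpposite.op_injective h4
    exact this ▸ h3.1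

open MeasureTheory in
/-- Averaging over the reversible transformations produces an invariant inner product. -/
theorem exists_invariant_form (S : OpSystem A) (h2 : S.Postulate2) :
    ∃ B : LinearMap.BilinForm ℝ A, (∀ x y, B x y = B y x) ∧ (∀ x, x ≠ 0 → 0 < B x x) ∧
      ∀ T, S.IsReversible T → ∀ x y, B (T x) (T y) = B x y := by
  have := S.compactSpace_reversibleSubgroup h2
  set G := S.reversibleSubgroup h2
  let : MeasurableSpace G := borel G
  have : BorelSpace G := ⟨rfl⟩
  let μ : Measure G := Measure.haar
  let b := Module.finBasis ℝ A
  let q : A → A → ℝ := fun x y => ∑ i, b.coord i x * b.coord i y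
  -- Acting through `g⁻¹` turns left translation by `t⁻¹` into precomposition with `T`, so left
  -- invariance of Haar measure is what is needed.
  let act : G → A → A := fun g x => (((g⁻¹ : G) : (A →L[ℝ] A)ˣ) : A →L[ℝ] A) x
  have hact : ∀ x, Continuous fun g => act g x := fun x =>
    (ContinuousLinearMap.apply ℝ A x).continuous.comp
      (Units.continuous_val.comp (continuous_subtype_val.comp continuous_inv))
  have hq : ∀ x y, Continuous fun g => q (act g x) (act g y) := fun x y =>
    continuous_finsetSum _ fun i _ =>
      ((LinearMap.continuous_of_finiteDimensional (b.coord i)).comp (hact x)).mul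
        ((LinearMap.continuous_of_finiteDimensional (b.coord i)).comp (hact y))
  have hint : ∀ x y, Integrable (fun g => q (act g x) (act g y)) μ := fun x y =>
    (hq x y).integrable_of_hasCompactSupport (HasCompactSupport.of_compactSpace _)
  have qadd : ∀ x x' y, q (x + x') y = q x y + q x' y := fun x x' y => by
    simp only [q, map_add, add_mul, Finset.sum_add_distrib]
  have qsmul : ∀ (c : ℝ) x y, q (c • x) y = c * q x y := fun c x y => by
    simp only [q, map_smul, smul_eq_mul, mul_assoc, Finset.mul_sum]
  have qsymm : ∀ x y, q x y = q y x := fun x y => by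
    simp only [q, mul_comm]
  have aadd : ∀ g x y, act g (x + y) = act g x + act g y := fun g x y => map_add _ x y
  have asmul : ∀ g (c : ℝ) x, act g (c • x) = c • act g x := fun g c x => map_smul _ c x
  let f : A → A → ℝ := fun x y => ∫ g, q (act g x) (act g y) ∂μ
  have fsymm : ∀ x y, f x y = f y x := fun x y => by simp only [f, qsymm]
  have fadd : ∀ x x' y, f (x + x') y = f x y + f x' y := fun x x' y => by
    simp only [f, aadd, qadd]
    exact integral_add (hint x y) (hint x' y)
  have fsmul : ∀ (c : ℝ) x y, f (c • x) y = c * f x y := fun c x y => by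
    simp only [f, asmul, qsmul]
    exact integral_const_mul _ _
  refine ⟨LinearMap.mk₂ ℝ f fadd fsmul (fun x y y' => ?_) (fun c x y => ?_), fsymm,
    fun x hx => ?_, fun T hT x y => ?_⟩
  · rw [fsymm, fadd, fsymm y, fsymm y']
  · rw [fsymm, fsmul, fsymm, smul_eq_mul]
  · have hnn : ∀ z, 0 ≤ q z z := fun z => Finset.sum_nonneg fun i _ => mul_self_nonneg _
    refine (hq x x).integral_pos_of_hasCompactSupport_nonneg_nonzero (x := 1)
      (HasCompactSupport.of_compactSpace _) (fun g => hnn _) ?_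
    have h1 : act 1 x = x := by simp [act]
    rw [h1]
    intro h0
    have := (Finset.sum_eq_zero_iff_of_nonneg fun i _ => mul_self_nonneg (b.coord i x)).1 h0
    exact hx (b.forall_coord_eq_zero_iff.1 fun i => by simpa using this i (Finset.mem_univ i))
  · obtain ⟨h1, T', h3, h4, h5⟩ := id hT
    let t : G := ⟨⟨T, T', h4, h5⟩, hT⟩
    have := integral_mul_left_eq_self (μ := μ) (fun g => q (act g x) (act g y)) t⁻¹
    have e : ∀ g z, act (t⁻¹ * g) z = act g (T z) := fun g z => by
      simp only [act, mul_inv_rev, inv_inv]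
      rfl
    simp only [e] at this
    exact this

/-- There is a state which is fixed by all reversible transformations. -/
theorem exists_invariant_state (S : OpSystem A) (h2 : S.Postulate2) :
    ∃ μ ∈ S.states, ∀ T, S.IsReversible T → T μ = μ := by
  obtain ⟨B, hs, hp, hi⟩ := S.exists_invariant_form h2
  have hc : Continuous fun x => B x x := by
    have h1 : Continuous fun p : A × A => B p.1 p.2 := by
      have : Continuous fun p : A × A =>
          (LinearMap.toContinuousLinearMap (LinearMap.toContinuousLinearMap.toLinearMap ∘ₗ B) p.1)
            p.2 := by fun_prop
      exact this
    exact h1.comp (continuous_id.prodMk continuous_id)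
  -- The invariant norm is strictly convex. If `T` moved the minimizer `μ`, the midpoint of `μ` and
  -- `T μ` would be a state of smaller norm.
  obtain ⟨μ, hμ, hmin⟩ := S.states_compact.exists_isMinOn S.states_nonempty hc.continuousOn
  refine ⟨μ, hμ, fun T hT => ?_⟩
  by_contra hne
  have hpos := hp _ (sub_ne_zero.2 hne)
  have hmid : (1 / 2 : ℝ) • T μ + (1 / 2 : ℝ) • μ ∈ S.states :=
    S.states_convex (hT.mem_states hμ) hμ (by norm_num) (by norm_num) (by norm_num)
  have := isMinOn_iff.1 hmin _ hmid
  simp only [map_add, map_sub, map_smul, LinearMap.add_apply, LinearMap.sub_apply,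
    LinearMap.smul_apply, smul_eq_mul, hi T hT, hs μ (T μ)] at this hpos
  linarith

/-! ### Maximal frames and the maximally mixed state -/

/-- `N` is the size of the maximal frames, and `μ` is the uniform mixture of each of them. -/
structure IsCapacity (S : OpSystem A) (N : ℕ) (μ : A) : Prop where
  pos : 0 < N
  mem_states : μ ∈ S.states
  fixed : ∀ T, S.IsReversible T → T μ = μ
  extend : ∀ (n : ℕ) (w : Fin n → A), S.IsFrame w → ∃ h : n ≤ N, ∃ v : Fin N → A,
    S.IsFrame v ∧ ∀ i, v (Fin.castLE h i) = w i
  sum_eq : ∀ v : Fin N → A, S.IsFrame v → ∑ i, v i = (N : ℝ) • μ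

/-- An invariant state is a uniform mixture of a frame. -/
theorem exists_uniform_frame {S : OpSystem A} (h1 : S.Postulate1) (h2 : S.Postulate2) {μ : A}
    (hμ : μ ∈ S.states) (hfix : ∀ T, S.IsReversible T → T μ = μ) :
    ∃ (N : ℕ) (w : Fin N → A), 0 < N ∧ S.IsFrame w ∧ ∑ i, w i = (N : ℝ) • μ := by
  obtain ⟨N, w, p, hw, hp, hsum, rfl⟩ := h1 μ hμ
  have hN : 0 < N := by
    rcases Nat.eq_zero_or_pos N with rfl | h
    · simp at hsum
    · exact h
  have hpe : ∀ i j, p i = p j := by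
    intro i j
    -- A reversible map exchanging `w i` and `w j` fixes `μ`; evaluating the effect `e j` before and
    -- after compares the two weights.
    obtain ⟨T, hT, h⟩ := h2 N _ _ hw (hw.comp (Equiv.swap i j).injective)
    obtain ⟨-, e, -, -, hd⟩ := id hw
    have h' := congrArg (e j) (hfix T hT)
    simp only [map_sum, map_smul, h, hd, smul_eq_mul] at h'
    rw [Finset.sum_eq_single i, Finset.sum_eq_single j] at h'
    · simpa using h'
    · intro b _ hb; simp [hb.symm]
    · simp
    · intro b _ hb
      rw [if_neg, mul_zero]
      intro hj
      apply hb
      rw [← (Equiv.swap i j).injective.eq_iff, ← hj, Equiv.swap_apply_left]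
    · simp
  refine ⟨N, w, hN, hw, ?_⟩
  have hNp : ∀ i, (N : ℝ) * p i = 1 := fun i => by
    rw [← hsum, Finset.sum_congr rfl fun j _ => hpe j i]
    simp
  rw [Finset.smul_sum]
  exact Finset.sum_congr rfl fun i _ => by rw [smul_smul, hNp, one_smul]

/-- The size `N` of a frame whose uniform mixture is the invariant state bounds every other frame,
because each distinguishing effect has value at least `1 / N` on `μ` and their sum is at most `1`.
Extension and the common barycentre follow by transporting this one frame with Postulate 2. -/
theorem exists_isCapacity {S : OpSystem A} (h1 : S.Postulate1) (h2 : S.Postulate2) :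
    ∃ N μ, S.IsCapacity N μ := by
  obtain ⟨μ, hμ, hfix⟩ := S.exists_invariant_state h2
  obtain ⟨N, w, hN, hw, hsum⟩ := exists_uniform_frame h1 h2 hμ hfix
  have hNR : (0 : ℝ) < N := Nat.cast_pos.2 hN
  have hle : ∀ (n : ℕ) (v : Fin n → A), S.IsFrame v → n ≤ N := by
    intro n v hv
    obtain ⟨hp, e, he, hs, hd⟩ := id hv
    have key : ∀ i, 1 ≤ (N : ℝ) * e i μ := by
      intro i
      -- A reversible copy of the uniform frame passes through `v i` and still has barycentre `μ`.
      -- Its member `v i` alone contributes `1` to `N * e i μ`.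
      obtain ⟨T, hT, hTi⟩ := exists_reversible_of_pure h2 (hw.1 ⟨0, hN⟩) (hp i)
      have h3 : (N : ℝ) * e i μ = ∑ j, e i (T (w j)) := by
        rw [← map_sum, ← map_sum, hsum, map_smul, map_smul, hfix T hT, smul_eq_mul]
      rw [h3]
      have h4 : e i (T (w ⟨0, hN⟩)) = 1 := by rw [hTi, hd]; simp
      rw [← h4]
      exact Finset.single_le_sum (f := fun j => e i (T (w j)))
        (fun j _ => S.allowed_nonneg (he i) (hT.isPure (hw.1 j)).mem_cone) (Finset.mem_univ _)
    have h5 : (n : ℝ) ≤ ∑ i, (N : ℝ) * e i μ := by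
      simpa using Finset.sum_le_sum fun i (_ : i ∈ (Finset.univ : Finset (Fin n))) => key i
    rw [← Finset.mul_sum] at h5
    have h6 := hs μ hμ
    rw [S.unit_eq_one μ hμ] at h6
    have : (n : ℝ) ≤ N := h5.trans (by nlinarith)
    exact_mod_cast this
  refine ⟨N, μ, hN, hμ, hfix, fun n v hv => ?_, fun v hv => ?_⟩
  · refine ⟨hle n v hv, ?_⟩
    obtain ⟨T, hT, h⟩ := h2 n _ _ (hw.comp (Fin.castLE_injective (hle n v hv))) hv
    exact ⟨_, hT.isFrame hw, h⟩
  · obtain ⟨T, hT, h⟩ := h2 N _ _ hw hv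
    rw [← Finset.sum_congr rfl fun i _ => h i, ← map_sum, hsum, map_smul, hfix T hT]

/-! ### Spectral decomposition along maximal frames -/

namespace IsCapacity

variable {S : OpSystem A} {N : ℕ} {μ : A}

theorem exists_frame_of_pure (hc : S.IsCapacity N μ) {ω : A} (hω : S.IsPure ω) :
    ∃ v : Fin N → A, S.IsFrame v ∧ v ⟨0, hc.pos⟩ = ω := by
  obtain ⟨h, v, hv, hi⟩ := hc.extend 1 _ (isFrame_single hω)
  exact ⟨v, hv, hi 0⟩

theorem sum_castLE {V : Type*} [AddCommMonoid V] {n N : ℕ} (h : n ≤ N) (f : Fin N → V)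
    (g : Fin n → V) (hfg : ∀ i, f (Fin.castLE h i) = g i)
    (hf : ∀ j : Fin N, ¬ (j : ℕ) < n → f j = 0) : ∑ i, f i = ∑ i, g i := by
  refine (Finset.sum_of_injOn (Fin.castLE h) (Fin.castLE_injective h).injOn (by simp) ?_
    fun i _ => (hfg i).symm).symm
  intro j _ hj
  exact hf j fun hlt => hj ⟨⟨j, hlt⟩, by simp, rfl⟩

/-- States are mixtures of maximal frames. -/
theorem exists_spectral_states (hc : S.IsCapacity N μ) (h1 : S.Postulate1) {ω : A}
    (hω : ω ∈ S.states) : ∃ (v : Fin N → A) (p : Fin N → ℝ), S.IsFrame v ∧ (∀ i, 0 ≤ p i) ∧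
      ∑ i, p i = 1 ∧ ω = ∑ i, p i • v i := by
  obtain ⟨n, w, p, hw, hp, hsum, rfl⟩ := h1 ω hω
  obtain ⟨h, v, hv, hvw⟩ := hc.extend n w hw
  refine ⟨v, fun j => if hj : (j : ℕ) < n then p ⟨j, hj⟩ else 0, hv, fun j => ?_, ?_, ?_⟩
  · by_cases hj : (j : ℕ) < n <;> simp [hj, hp]
  · rw [← hsum]
    exact sum_castLE h _ _ (fun i => by simp) fun j hj => by simp [hj]
  · exact (sum_castLE h _ _ (fun i => by simp [hvw]) fun j hj => by simp [hj]).symm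

theorem sub_mem_cone_of_frame (hc : S.IsCapacity N μ) {v : Fin N → A} (hv : S.IsFrame v)
    {p : Fin N → ℝ} (hp : ∀ i, p i ≤ 1) : (N : ℝ) • μ - ∑ i, p i • v i ∈ S.cone := by
  rw [← hc.sum_eq v hv, ← Finset.sum_sub_distrib]
  refine S.sum_mem_cone _ fun i _ => ?_
  have := S.smul_mem_cone (sub_nonneg.2 (hp i)) (hv.1 i).mem_cone
  rwa [sub_smul, one_smul] at this

/-- The state `μ` is an order unit: if `ω = ∑ p_i v_i` along a maximal frame, then `N μ - ω = ∑ (1 -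
p_i) v_i`. Both signs are carried through the span induction so that negative scalars can be
handled. -/
theorem exists_add_smul_mem_cone (hc : S.IsCapacity N μ) (h1 : S.Postulate1) (x : A) :
    ∃ t : ℝ, 0 ≤ t ∧ x + t • μ ∈ S.cone := by
  have hμ := S.mem_cone_of_mem_states hc.mem_states
  have key : ∀ x : A, x ∈ Submodule.span ℝ S.states →
      ∃ t : ℝ, 0 ≤ t ∧ x + t • μ ∈ S.cone ∧ -x + t • μ ∈ S.cone := by
    intro x hx
    induction hx using Submodule.span_induction with
    | mem x hx =>
      obtain ⟨v, p, hv, hp, hsum, e⟩ := hc.exists_spectral_states h1 hx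
      refine ⟨N, Nat.cast_nonneg _, S.add_mem_cone (S.mem_cone_of_mem_states hx)
        (S.smul_mem_cone (Nat.cast_nonneg _) hμ), ?_⟩
      rw [neg_add_eq_sub, e]
      exact hc.sub_mem_cone_of_frame hv fun i =>
        hsum ▸ Finset.single_le_sum (fun j _ => hp j) (Finset.mem_univ i)
    | zero => exact ⟨0, le_rfl, by simpa using S.zero_mem_cone, by simpa using S.zero_mem_cone⟩
    | add x y _ _ hx hy =>
      obtain ⟨s, hs, hx1, hx2⟩ := hx
      obtain ⟨t, ht, hy1, hy2⟩ := hy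
      refine ⟨s + t, add_nonneg hs ht, ?_, ?_⟩
      · convert S.add_mem_cone hx1 hy1 using 1
        module
      · convert S.add_mem_cone hx2 hy2 using 1
        module
    | smul a x _ hx =>
      obtain ⟨s, hs, hx1, hx2⟩ := hx
      refine ⟨|a| * s, by positivity, ?_, ?_⟩
      · rcases le_total 0 a with ha | ha
        · rw [abs_of_nonneg ha]
          convert S.smul_mem_cone ha hx1 using 1
          module
        · rw [abs_of_nonpos ha]
          convert S.smul_mem_cone (neg_nonneg.2 ha) hx2 using 1
          module
      · rcases le_total 0 a with ha | ha
        · rw [abs_of_nonneg ha]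
          convert S.smul_mem_cone ha hx2 using 1
          module
        · rw [abs_of_nonpos ha]
          convert S.smul_mem_cone (neg_nonneg.2 ha) hx1 using 1
          module
  obtain ⟨t, ht, h, -⟩ := key x (S.states_span ▸ Submodule.mem_top)
  exact ⟨t, ht, h⟩

/-- Every vector is a linear combination of a maximal frame. -/
theorem exists_spectral (hc : S.IsCapacity N μ) (h1 : S.Postulate1) (x : A) :
    ∃ (v : Fin N → A) (l : Fin N → ℝ), S.IsFrame v ∧ x = ∑ i, l i • v i := by
  obtain ⟨t, -, h⟩ := hc.exists_add_smul_mem_cone h1 x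
  obtain ⟨ω, hω, e⟩ := S.exists_eq_unit_smul h
  obtain ⟨v, p, hv, -, -, rfl⟩ := hc.exists_spectral_states h1 hω
  have hN : (N : ℝ) ≠ 0 := Nat.cast_ne_zero.2 hc.pos.ne'
  generalize S.unit (x + t • μ) = r at e
  refine ⟨v, fun i => r * p i - t / N, hv, ?_⟩
  have hμ : t • μ = ∑ i, (t / N) • v i := by
    rw [← Finset.smul_sum, hc.sum_eq v hv, smul_smul, div_mul_cancel₀ _ hN]
  rw [eq_sub_of_add_eq e, hμ, Finset.smul_sum, ← Finset.sum_sub_distrib]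
  refine Finset.sum_congr rfl fun i _ => ?_
  module

end IsCapacity

/-! ### Bilinear forms for which the maximal frames are orthonormal -/

/-- A symmetric bilinear form for which all frames of size `N` are orthonormal. -/
structure IsFrameForm (S : OpSystem A) (N : ℕ) (C : LinearMap.BilinForm ℝ A) : Prop where
  symm : ∀ x y, C x y = C y x
  frame : ∀ v : Fin N → A, S.IsFrame v → ∀ i j, C (v i) (v j) = if i = j then 1 else 0

theorem exists_riesz {V : Type*} [AddCommGroup V] [Module ℝ V] [FiniteDimensional ℝ V]
    {C : LinearMap.BilinForm ℝ V} (hp : ∀ x, x ≠ 0 → 0 < C x x)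
    (f : Module.Dual ℝ V) : ∃ a, ∀ x, C a x = f x := by
  have hinj : Function.Injective C := by
    refine (injective_iff_map_eq_zero C).2 fun x hx => ?_
    by_contra h
    have := hp x h
    rw [hx] at this
    simp at this
  have hsurj : Function.Surjective C :=
    (LinearMap.injective_iff_surjective_of_finrank_eq_finrank
      (Subspace.dual_finrank_eq (K := ℝ) (V := V)).symm).1 hinj
  obtain ⟨a, ha⟩ := hsurj f
  exact ⟨a, fun x => by rw [ha]⟩

namespace IsFrameForm

variable {S : OpSystem A} {N : ℕ} {μ : A} {C : LinearMap.BilinForm ℝ A}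

theorem apply_sum (hC : S.IsFrameForm N C) {v : Fin N → A} (hv : S.IsFrame v)
    (l : Fin N → ℝ) (i : Fin N) : C (∑ j, l j • v j) (v i) = l i := by
  simp [hC.frame v hv]

theorem apply_sum_sum (hC : S.IsFrameForm N C) {v : Fin N → A} (hv : S.IsFrame v)
    (l m : Fin N → ℝ) : C (∑ j, l j • v j) (∑ j, m j • v j) = ∑ i, l i * m i := by
  rw [map_sum]
  refine Finset.sum_congr rfl fun i _ => ?_
  rw [map_smul, hC.apply_sum hv, smul_eq_mul, mul_comm]

theorem posDef (hC : S.IsFrameForm N C) (hc : S.IsCapacity N μ) (h1 : S.Postulate1) (x : A)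
    (hx : x ≠ 0) : 0 < C x x := by
  obtain ⟨v, l, hv, rfl⟩ := hc.exists_spectral h1 x
  rw [hC.apply_sum_sum hv]
  refine lt_of_le_of_ne (Finset.sum_nonneg fun i _ => mul_self_nonneg _) fun h => hx ?_
  have := (Finset.sum_eq_zero_iff_of_nonneg fun i _ => mul_self_nonneg (l i)).1 h.symm
  exact Finset.sum_eq_zero fun i hi => by
    rw [mul_self_eq_zero.1 (this i hi), zero_smul]

theorem pure_self (hC : S.IsFrameForm N C) (hc : S.IsCapacity N μ) {ω : A} (hω : S.IsPure ω) :
    C ω ω = 1 := by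
  obtain ⟨v, hv, rfl⟩ := hc.exists_frame_of_pure hω
  simp [hC.frame v hv]

/-- The effects of a maximal frame are the functionals represented by its elements. -/
theorem effect_eq (hC : S.IsFrameForm N C) (hc : S.IsCapacity N μ) (h1 : S.Postulate1)
    {v : Fin N → A} (hv : S.IsFrame v) {e : A →L[ℝ] ℝ} (he : e ∈ S.allowed) {i : Fin N}
    (hd : ∀ j, e (v j) = if i = j then 1 else 0) (x : A) : e x = C (v i) x := by
  -- Expand the representative `a` of `e` along a maximal frame `w`. Its coefficients are the values
  -- `e (w j)` in `[0, 1]`, and they add up to `e (N μ) = 1`, so `‖a‖² ≤ 1`. Together with `⟨a, v i⟩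
  -- = 1 = ‖v i‖²` this gives `‖a - v i‖² ≤ 0`.
  obtain ⟨a, ha⟩ := exists_riesz (hC.posDef hc h1) e.toLinearMap
  have ha' : ∀ x, C a x = e x := ha
  obtain ⟨w, l, hw, hal⟩ := hc.exists_spectral h1 a
  have hl : ∀ j, l j = e (w j) := fun j => by rw [← ha', hal, hC.apply_sum hw]
  have hsum : ∑ j, l j = 1 := by
    rw [Finset.sum_congr rfl fun j _ => hl j, ← map_sum, hc.sum_eq w hw, ← hc.sum_eq v hv]
    simp [hd]
  have haa : C a a ≤ 1 := by
    rw [hal, hC.apply_sum_sum hw, ← hsum]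
    refine Finset.sum_le_sum fun j _ => ?_
    have := S.allowed_effect e he (w j) (hw.1 j).mem_states
    rw [← hl] at this
    nlinarith
  have hav : C a (v i) = 1 := by rw [ha', hd, if_pos rfl]
  have hvv := hC.pure_self hc (hv.1 i)
  have : a = v i := by
    by_contra hne
    have := hC.posDef hc h1 _ (sub_ne_zero.2 hne)
    simp only [map_sub, LinearMap.sub_apply, hC.symm (v i) a, hav, hvv] at this
    linarith
  rw [← ha', this]

theorem allowed_of_pure (hC : S.IsFrameForm N C) (hc : S.IsCapacity N μ) (h1 : S.Postulate1)
    {ω : A} (hω : S.IsPure ω) : LinearMap.toContinuousLinearMap (C ω) ∈ S.allowed := by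
  obtain ⟨v, hv, rfl⟩ := hc.exists_frame_of_pure hω
  obtain ⟨-, e, he, -, hd⟩ := id hv
  convert he ⟨0, hc.pos⟩
  ext x
  exact (hC.effect_eq hc h1 hv (he _) (hd _) x).symm

theorem sum_apply_le (hC : S.IsFrameForm N C) (hc : S.IsCapacity N μ) (h1 : S.Postulate1)
    {v : Fin N → A} (hv : S.IsFrame v) {ω : A} (hω : ω ∈ S.states) :
    ∑ i, C (v i) ω ≤ 1 := by
  obtain ⟨-, e, he, hs, hd⟩ := id hv
  rw [← S.unit_eq_one ω hω, ← Finset.sum_congr rfl fun i _ =>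
    hC.effect_eq hc h1 hv (he _) (hd _) ω]
  exact hs ω hω

theorem nonneg (hC : S.IsFrameForm N C) (hc : S.IsCapacity N μ) (h1 : S.Postulate1)
    {x y : A} (hx : x ∈ S.cone) (hy : y ∈ S.cone) : 0 ≤ C x y := by
  obtain ⟨r, hr, ω, hω, rfl⟩ := hx
  obtain ⟨v, p, hv, hp, -, rfl⟩ := hc.exists_spectral_states h1 hω
  simp only [map_smul, map_sum, LinearMap.smul_apply, LinearMap.sum_apply, smul_eq_mul]
  refine mul_nonneg hr (Finset.sum_nonneg fun i _ => mul_nonneg (hp i) ?_)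
  exact S.allowed_nonneg (hC.allowed_of_pure hc h1 (hv.1 i)) hy

/-- The vector `N μ` is the sum of any maximal frame, in particular of one along which `x` is
diagonal. -/
theorem apply_mixed (hC : S.IsFrameForm N C) (hc : S.IsCapacity N μ) (h1 : S.Postulate1)
    (x : A) : (N : ℝ) * C μ x = S.unit x := by
  obtain ⟨v, l, hv, rfl⟩ := hc.exists_spectral h1 x
  have : (N : ℝ) * C μ (∑ i, l i • v i) = C ((N : ℝ) • μ) (∑ i, l i • v i) := by
    rw [map_smul, LinearMap.smul_apply, smul_eq_mul]
  rw [this, ← hc.sum_eq v hv]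
  have h := hC.apply_sum_sum hv (fun _ => 1) l
  simp only [one_smul, one_mul] at h
  rw [h, map_sum]
  exact Finset.sum_congr rfl fun i _ => by rw [map_smul, (hv.1 i).unit_eq, smul_eq_mul, mul_one]

theorem selfDual (hC : S.IsFrameForm N C) (hc : S.IsCapacity N μ) (h1 : S.Postulate1) :
    {y | ∀ x ∈ S.cone, 0 ≤ C y x} = S.cone := by
  ext y
  refine ⟨fun h => ?_, fun h x hx => hC.nonneg hc h1 h hx⟩
  obtain ⟨v, l, hv, rfl⟩ := hc.exists_spectral h1 y
  refine S.sum_mem_cone _ fun i _ => S.smul_mem_cone ?_ (hv.1 i).mem_cone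
  have := h _ (hv.1 i).mem_cone
  rwa [hC.apply_sum hv] at this

/-- For spectral weights, `∑ p_i² ≤ ∑ p_i = 1`. Equality makes every weight `0` or `1`, so the state
would be a member of the frame. -/
theorem mixed_lt (hC : S.IsFrameForm N C) (hc : S.IsCapacity N μ) (h1 : S.Postulate1) {ω : A}
    (hω : ω ∈ S.states) (hp : ¬ S.IsPure ω) : C ω ω < 1 := by
  obtain ⟨v, p, hv, hp0, hsum, rfl⟩ := hc.exists_spectral_states h1 hω
  rw [hC.apply_sum_sum hv, ← hsum]
  have hle : ∀ i, p i ≤ 1 := fun i =>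
    hsum ▸ Finset.single_le_sum (fun j _ => hp0 j) (Finset.mem_univ i)
  by_contra hcon
  have heq := le_antisymm (Finset.sum_le_sum fun i (_ : i ∈ Finset.univ) =>
    mul_le_of_le_one_left (hp0 i) (hle i)) (not_lt.1 hcon)
  have h01 := (Finset.sum_eq_sum_iff_of_le fun i _ =>
    mul_le_of_le_one_left (hp0 i) (hle i)).1 heq
  obtain ⟨i, hi⟩ : ∃ i, p i ≠ 0 := by
    by_contra! h
    simp [h] at hsum
  have hi1 : p i = 1 := by
    have := h01 i (Finset.mem_univ i)
    exact mul_right_cancel₀ hi (by linarith)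
  refine hp ?_
  have hz : ∀ j, j ≠ i → p j = 0 := by
    intro j hj
    have h2 : p i + p j ≤ 1 := by
      rw [← hsum, ← Finset.sum_pair hj.symm]
      exact Finset.sum_le_sum_of_subset_of_nonneg (Finset.subset_univ _) fun k _ _ => hp0 k
    linarith [hp0 j]
  rw [Finset.sum_eq_single i (fun j _ hj => by rw [hz j hj, zero_smul]) (by simp), hi1, one_smul]
  exact hv.1 i

theorem isSelfDualizing (hC : S.IsFrameForm N C) (hc : S.IsCapacity N μ) (h1 : S.Postulate1)
    (hinv : ∀ T, S.IsReversible T → ∀ x y, C (T x) (T y) = C x y) : S.IsSelfDualizing C where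
  symm := hC.symm
  pos := hC.posDef hc h1
  selfDual := hC.selfDual hc h1
  invariant := hinv
  pure_norm ω hω := by rw [hC.pure_self hc hω, Real.sqrt_one]
  mixed_norm ω hω hp := by
    rw [Real.sqrt_lt' one_pos, one_pow]
    exact hC.mixed_lt hc h1 hω hp

end IsFrameForm

/-- An invariant inner product is an affine combination of `u ⊗ u` and a form for which frames are
orthonormal. -/
theorem exists_frameForm_of_invariant {S : OpSystem A} (h2 : S.Postulate2) {N : ℕ} {μ : A}
    (hc : S.IsCapacity N μ) {B : LinearMap.BilinForm ℝ A} (hs : ∀ x y, B x y = B y x)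
    (hp : ∀ x, x ≠ 0 → 0 < B x x)
    (hinv : ∀ T, S.IsReversible T → ∀ x y, B (T x) (T y) = B x y) :
    ∃ (a c : ℝ) (C : LinearMap.BilinForm ℝ A), c < a ∧ S.IsFrameForm N C ∧
      (∀ ω, S.IsPure ω → B ω ω = a) ∧
      (∀ v : Fin N → A, S.IsFrame v → ∀ i j, i ≠ j → B (v i) (v j) = c) ∧
      ∀ x y, C x y = (a - c)⁻¹ * (B x y - c * (S.unit x * S.unit y)) := by
  obtain ⟨φ, hφ⟩ : ∃ φ, S.IsPure φ := S.states_compact.extremePoints_nonempty S.states_nonempty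
  obtain ⟨w, hw, -⟩ := hc.exists_frame_of_pure hφ
  have ha : ∀ ω, S.IsPure ω → B ω ω = B φ φ := fun ω hω => by
    obtain ⟨T, hT, rfl⟩ := exists_reversible_of_pure h2 hφ hω
    exact hinv T hT _ _
  have hφ0 : φ ≠ 0 := fun h => by simpa [h] using hφ.unit_eq
  obtain ⟨c, hca, hcv⟩ : ∃ c, c < B φ φ ∧
      ∀ v : Fin N → A, S.IsFrame v → ∀ i j, i ≠ j → B (v i) (v j) = c := by
    by_cases hN : ∃ i j : Fin N, i ≠ j
    · obtain ⟨i, j, hij⟩ := hN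
      refine ⟨B (w i) (w j), ?_, fun v hv i' j' hij' => ?_⟩
      · have hne : w i ≠ w j := by
          obtain ⟨-, e, -, -, hd⟩ := hw
          intro h
          have h3 := hd i j
          rw [← h, hd] at h3
          simp [hij] at h3
        have := hp _ (sub_ne_zero.2 hne)
        simp only [map_sub, LinearMap.sub_apply, hs (w j) (w i), ha _ (hw.1 i),
          ha _ (hw.1 j)] at this
        linarith
      · obtain ⟨T, hT, h⟩ := h2 2 _ _ (hw.pair hij) (hv.pair hij')
        have h0 := h 0
        have h1 := h 1
        simp only [Matrix.cons_val_zero, Matrix.cons_val_one] at h0 h1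
        rw [← h0, ← h1, hinv T hT]
    · push Not at hN
      -- With maximal frames of size one there are no off-diagonal values; any `c < a` would do.
      exact ⟨0, hp φ hφ0, fun v _ i j hij => absurd (hN i j) hij⟩
  have hne : B φ φ - c ≠ 0 := sub_ne_zero.2 hca.ne'
  refine ⟨B φ φ, c, (B φ φ - c)⁻¹ • (B - c • LinearMap.BilinForm.linMulLin S.unit.toLinearMap
    S.unit.toLinearMap), hca, ⟨fun x y => ?_, fun v hv i j => ?_⟩, ha, hcv, fun x y => ?_⟩
  · simp [hs x y, mul_comm (S.unit x)]
  · by_cases hij : i = j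
    · subst hij
      simp [ha _ (hv.1 i), (hv.1 i).unit_eq, hne]
    · simp [hcv v hv i j hij, (hv.1 i).unit_eq, (hv.1 j).unit_eq, hij]
  · simp

/-- The Haar average need not be admissible. Its correction by a multiple of `u ⊗ u` is, and stays
invariant because reversible maps preserve `u`. -/
theorem exists_isSelfDualizing {S : OpSystem A} (h1 : S.Postulate1) (h2 : S.Postulate2) :
    ∃ B : LinearMap.BilinForm ℝ A, S.IsSelfDualizing B := by
  obtain ⟨N, μ, hc⟩ := exists_isCapacity h1 h2
  obtain ⟨B, hs, hp, hinv⟩ := S.exists_invariant_form h2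
  obtain ⟨a, c, C, -, hC, -, -, e⟩ := exists_frameForm_of_invariant h2 hc hs hp hinv
  refine ⟨C, hC.isSelfDualizing hc h1 fun T hT x y => ?_⟩
  rw [e, e, hinv T hT, hT.unit_apply, hT.unit_apply]

/-- Frames are orthonormal for every admissible inner product. -/
theorem IsSelfDualizing.isFrameForm {S : OpSystem A} (h1 : S.Postulate1) (h2 : S.Postulate2)
    {N : ℕ} {μ : A} (hc : S.IsCapacity N μ) {B : LinearMap.BilinForm ℝ A}
    (hB : S.IsSelfDualizing B) : S.IsFrameForm N B := by
  obtain ⟨a, c, C, hca, hC, ha, hcv, e⟩ :=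
    exists_frameForm_of_invariant h2 hc hB.symm hB.pos hB.invariant
  have hself : ∀ ω, S.IsPure ω → B ω ω = 1 := fun ω hω => Real.sqrt_eq_one.1 (hB.pure_norm ω hω)
  refine ⟨hB.symm, fun v hv i j => ?_⟩
  obtain rfl : a = 1 := by rw [← ha _ (hv.1 i), hself _ (hv.1 i)]
  by_cases hij : i = j
  · subst hij
    simp [hself _ (hv.1 i)]
  rw [hcv v hv i j hij, if_neg hij]
  have hpos : 0 < 1 - c := sub_pos.2 hca
  have hBC : ∀ x y, B x y = (1 - c) * C x y + c * (S.unit x * S.unit y) := fun x y => by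
    rw [e]
    field_simp
    ring
  have hdual : ∀ {y}, y ∈ S.cone ↔ ∀ x ∈ S.cone, 0 ≤ B y x := fun {y} => by
    conv_lhs => rw [← hB.selfDual]
    rfl
  -- It remains to exclude `c > 0`: then the cone dual to `B` would contain a vector outside the
  -- cone.
  have hc0 : 0 ≤ c := by
    rw [← hcv v hv i j hij]
    exact hdual.1 (hv.1 i).mem_cone _ (hv.1 j).mem_cone
  by_contra hne
  have hc0' : 0 < c := lt_of_le_of_ne hc0 (Ne.symm hne)
  have hN : (0 : ℝ) < N := Nat.cast_pos.2 hc.pos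
  have hμ : ∀ x, C μ x = S.unit x / N := fun x => by
    rw [← hC.apply_mixed hc h1 x]
    field_simp
  -- On the cone `B (v i)` is at least `c u`, whereas `B μ` is at most `u`, so `v i - c μ` is in the
  -- `B`-dual cone. Its pairing with `v j` under `C` is `-c / N`, which contradicts positivity of
  -- `C`.
  have hmem : v i - c • μ ∈ S.cone := by
    refine hdual.2 fun x hx => ?_
    have h3 : B μ x ≤ S.unit x := by
      rw [hBC, hμ, S.unit_eq_one μ hc.mem_states]
      have : S.unit x / N ≤ S.unit x :=
        div_le_self (S.unit_nonneg hx) (Nat.one_le_cast.2 hc.pos)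
      nlinarith
    have h4 : c * S.unit x ≤ B (v i) x := by
      rw [hBC, (hv.1 i).unit_eq]
      have := mul_nonneg hpos.le (hC.nonneg hc h1 (hv.1 i).mem_cone hx)
      linarith
    simp only [map_sub, map_smul, LinearMap.sub_apply, LinearMap.smul_apply, smul_eq_mul]
    nlinarith
  have h5 := hC.nonneg hc h1 hmem (hv.1 j).mem_cone
  simp only [map_sub, map_smul, LinearMap.sub_apply, LinearMap.smul_apply, smul_eq_mul,
    hC.frame v hv, if_neg hij, hμ, (hv.1 j).unit_eq] at h5
  have : 0 < c * (1 / (N : ℝ)) := by positivity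
  linarith

/-! ### Orthogonal sets of pure states -/

/-- Orthogonal pure states form a frame. -/
theorem IsFrameForm.isFrame_of_orthogonal {S : OpSystem A} {N : ℕ} {μ : A}
    {C : LinearMap.BilinForm ℝ A} (hC : S.IsFrameForm N C) (hc : S.IsCapacity N μ)
    (h1 : S.Postulate1) : ∀ {n : ℕ} (w : Fin n → A), (∀ i, S.IsPure (w i)) →
      (∀ i j, i ≠ j → C (w i) (w j) = 0) → S.IsFrame w
  | 0, w, _, _ => ⟨fun i => i.elim0, fun i => i.elim0, fun i => i.elim0,
      fun ω hω => by simp [S.unit_eq_one ω hω], fun i => i.elim0⟩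
  | n + 1, w, hp, ho => by
    have ih := hC.isFrame_of_orthogonal hc h1 (fun i : Fin n => w i.castSucc) (fun i => hp _)
      fun i j hij => ho _ _ fun h => hij (Fin.castSucc_injective n h)
    obtain ⟨h, v, hv, hvw⟩ := hc.extend n _ ih
    let e : Fin n → (A →L[ℝ] ℝ) := fun i => LinearMap.toContinuousLinearMap (C (w i.castSucc))
    have hle : ∀ ω ∈ S.states, ∑ i, e i ω ≤ 1 := by
      intro ω hω
      refine le_trans ?_ (hC.sum_apply_le hc h1 hv hω)
      have h3 : ∀ i, e i ω = C (v (Fin.castLE h i)) ω := fun i => by rw [hvw]; rfl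
      rw [Finset.sum_congr rfl fun i _ => h3 i,
        ← Finset.sum_image (s := Finset.univ) (g := Fin.castLE h) (f := fun i => C (v i) ω)
          fun a _ b _ hab => Fin.castLE_injective h hab]
      exact Finset.sum_le_sum_of_subset_of_nonneg (Finset.subset_univ _) fun i _ _ =>
        hC.nonneg hc h1 (hv.1 i).mem_cone (S.mem_cone_of_mem_states hω)
    have hall : ∀ i, e i ∈ S.allowed := fun i => hC.allowed_of_pure hc h1 (hp _)
    have hsum := S.sum_allowed Finset.univ (fun i _ => hall i) hle
    -- The complement `u - ∑ e_i` serves for the last state. It is allowed and vanishes on the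
    -- earlier states, and it avoids having to bound the sum of all `n + 1` pure effects.
    refine ⟨hp, fun i => Fin.lastCases (motive := fun _ => A →L[ℝ] ℝ) (S.unit - ∑ i, e i) e i,
      fun i => ?_, fun ω hω => ?_, fun i j => ?_⟩
    · induction i using Fin.lastCases with
      | last => simpa using S.compl_allowed _ hsum
      | cast i => simpa using hall i
    · simp [Fin.sum_univ_castSucc]
    · have hd : ∀ i j, C (w i) (w j) = if i = j then 1 else 0 := fun i j => by
        by_cases hij : i = j
        · simp [hij, hC.pure_self hc (hp j)]
        · simp [hij, ho i j hij]
      induction i using Fin.lastCases with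
      | last =>
        simp only [Fin.lastCases_last, sub_apply, sum_apply, (hp j).unit_eq, e,
          LinearMap.coe_toContinuousLinearMap', hd]
        induction j using Fin.lastCases with
        | last => simp [Fin.castSucc_ne_last]
        | cast j => simp [(Fin.castSucc_ne_last j).symm]
      | cast i =>
        simp [e, hd]

/-- A finite set of mutually orthogonal pure states. -/
def IsOrthoPure (S : OpSystem A) (B : LinearMap.BilinForm ℝ A) (s : Finset A) : Prop :=
  (∀ ω ∈ s, S.IsPure ω) ∧ ∀ ω ∈ s, ∀ φ ∈ s, ω ≠ φ → B ω φ = 0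

/-- The cone of states is self-dual for `B`, its elements are positive combinations of orthogonal
pure states, and every set of orthogonal pure states extends to one that sums up to the order
unit `I`. -/
structure IsSpectral (S : OpSystem A) (B : LinearMap.BilinForm ℝ A) (I : A) : Prop where
  symm : ∀ x y, B x y = B y x
  pos : ∀ x, x ≠ 0 → 0 < B x x
  mem_cone_iff : ∀ y, y ∈ S.cone ↔ ∀ x ∈ S.cone, 0 ≤ B y x
  pure_self : ∀ ω, S.IsPure ω → B ω ω = 1
  apply_one : ∀ x, B I x = S.unit x
  extend : ∀ s, S.IsOrthoPure B s → ∃ t, s ⊆ t ∧ S.IsOrthoPure B t ∧ ∑ ω ∈ t, ω = I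
  decomp : ∀ x ∈ S.cone, ∃ (s : Finset A) (l : A → ℝ), S.IsOrthoPure B s ∧
    (∀ ω ∈ s, 0 < l ω) ∧ x = ∑ ω ∈ s, l ω • ω

theorem IsSelfDualizing.exists_isSpectral {S : OpSystem A} (h1 : S.Postulate1)
    (h2 : S.Postulate2) {B : LinearMap.BilinForm ℝ A} (hB : S.IsSelfDualizing B) :
    ∃ I, S.IsSpectral B I := by
  classical
  obtain ⟨N, μ, hc⟩ := exists_isCapacity h1 h2
  have hC := hB.isFrameForm h1 h2 hc
  have hinj : ∀ v : Fin N → A, S.IsFrame v → Function.Injective v := by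
    intro v hv i j hij
    by_contra hne
    have := hC.frame v hv i j
    rw [hij, hC.pure_self hc (hv.1 j), if_neg hne] at this
    exact one_ne_zero this
  have horth : ∀ v : Fin N → A, S.IsFrame v → ∀ s : Finset (Fin N),
      S.IsOrthoPure B (s.image v) := by
    intro v hv s
    refine ⟨fun ω hω => ?_, fun ω hω φ hφ hne => ?_⟩
    · obtain ⟨i, -, rfl⟩ := Finset.mem_image.1 hω
      exact hv.1 i
    · obtain ⟨i, -, rfl⟩ := Finset.mem_image.1 hω
      obtain ⟨j, -, rfl⟩ := Finset.mem_image.1 hφ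
      rw [hC.frame v hv, if_neg fun h => hne (congrArg v h)]
  refine ⟨(N : ℝ) • μ, hB.symm, hB.pos, fun y => ?_, fun ω hω => hC.pure_self hc hω,
    fun x => ?_, fun s hs => ?_, fun x hx => ?_⟩
  · conv_lhs => rw [← hB.selfDual]
    rfl
  · rw [map_smul, LinearMap.smul_apply, smul_eq_mul, hC.apply_mixed hc h1]
  · let e := s.equivFin.symm
    have hw := hC.isFrame_of_orthogonal hc h1 (fun i => (e i : A)) (fun i => hs.1 _ (e i).2)
      fun i j hij => hs.2 _ (e i).2 _ (e j).2 fun h => hij (e.injective (Subtype.ext h))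
    obtain ⟨h, v, hv, hvw⟩ := hc.extend _ _ hw
    refine ⟨Finset.univ.image v, fun ω hω => ?_, horth v hv _, ?_⟩
    · refine Finset.mem_image.2 ⟨Fin.castLE h (e.symm ⟨ω, hω⟩), Finset.mem_univ _, ?_⟩
      rw [hvw, Equiv.apply_symm_apply]
    · rw [Finset.sum_image fun a _ b _ hab => hinj v hv hab, hc.sum_eq v hv]
  · obtain ⟨r, hr, ω, hω, rfl⟩ := hx
    obtain ⟨v, p, hv, hp, -, rfl⟩ := hc.exists_spectral_states h1 hω
    have : Nonempty (Fin N) := ⟨⟨0, hc.pos⟩⟩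
    have hl : ∀ i, Function.invFun v (v i) = i := Function.leftInverse_invFun (hinj v hv)
    let s := Finset.univ.filter fun i => r * p i ≠ 0
    refine ⟨s.image v, fun x => r * p (Function.invFun v x), horth v hv _, fun ω hω => ?_, ?_⟩
    · obtain ⟨i, hi, rfl⟩ := Finset.mem_image.1 hω
      simp only [hl]
      exact lt_of_le_of_ne (mul_nonneg hr (hp i)) (Finset.mem_filter.1 hi).2.symm
    · rw [Finset.sum_image fun a _ b _ hab => hinj v hv hab, Finset.sum_filter, Finset.smul_sum]
      refine Finset.sum_congr rfl fun i _ => ?_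
      simp only [hl, smul_smul]
      split_ifs with h
      · rfl
      · rw [not_not.1 h, zero_smul]

/-! ### Projective units and their faces -/

/-- Sums of mutually orthogonal pure states. -/
def IsProj (S : OpSystem A) (B : LinearMap.BilinForm ℝ A) (p : A) : Prop :=
  ∃ s, S.IsOrthoPure B s ∧ p = ∑ ω ∈ s, ω

/-- The face of all `x` in the cone on which `p` agrees with the unit. -/
def projFace (S : OpSystem A) (B : LinearMap.BilinForm ℝ A) (p : A) : Set A :=
  {x | x ∈ S.cone ∧ B x p = S.unit x}

theorem IsProj.mem_cone {S : OpSystem A} {B : LinearMap.BilinForm ℝ A} {p : A}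
    (hp : S.IsProj B p) : p ∈ S.cone := by
  obtain ⟨s, hs, rfl⟩ := hp
  exact S.sum_mem_cone _ fun ω hω => (hs.1 ω hω).mem_cone

theorem isOrthoPure_singleton {S : OpSystem A} {B : LinearMap.BilinForm ℝ A} {ω : A}
    (h : S.IsPure ω) : S.IsOrthoPure B {ω} := by
  refine ⟨by simpa using h, ?_⟩
  simp only [Finset.mem_singleton]
  rintro _ rfl _ rfl hne
  exact absurd rfl hne

theorem isProj_of_pure {S : OpSystem A} {B : LinearMap.BilinForm ℝ A} {ω : A}
    (h : S.IsPure ω) : S.IsProj B ω :=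
  ⟨{ω}, isOrthoPure_singleton h, by simp⟩

theorem isProj_zero {S : OpSystem A} {B : LinearMap.BilinForm ℝ A} : S.IsProj B 0 :=
  ⟨∅, ⟨by simp, by simp⟩, by simp⟩

theorem IsOrthoPure.mono {S : OpSystem A} {B : LinearMap.BilinForm ℝ A} {s t : Finset A}
    (ht : S.IsOrthoPure B t) (h : s ⊆ t) : S.IsOrthoPure B s :=
  ⟨fun ω hω => ht.1 ω (h hω), fun ω hω φ hφ => ht.2 ω (h hω) φ (h hφ)⟩

theorem IsOrthoPure.union {S : OpSystem A} {B : LinearMap.BilinForm ℝ A} [DecidableEq A]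
    (hB : ∀ x y, B x y = B y x) {s t : Finset A}
    (hs : S.IsOrthoPure B s) (ht : S.IsOrthoPure B t) (h : ∀ ω ∈ s, ∀ φ ∈ t, B ω φ = 0) :
    S.IsOrthoPure B (s ∪ t) := by
  constructor
  · intro ω hω
    rcases Finset.mem_union.1 hω with h1 | h1
    exacts [hs.1 ω h1, ht.1 ω h1]
  · intro ω hω φ hφ hne
    rcases Finset.mem_union.1 hω with h1 | h1 <;> rcases Finset.mem_union.1 hφ with h2 | h2
    exacts [hs.2 ω h1 φ h2 hne, h ω h1 φ h2, hB ω φ ▸ h φ h2 ω h1, ht.2 ω h1 φ h2 hne]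

namespace IsSpectral

variable {S : OpSystem A} {B : LinearMap.BilinForm ℝ A} {I : A}

theorem nonneg (h : S.IsSpectral B I) {x y : A} (hx : x ∈ S.cone) (hy : y ∈ S.cone) :
    0 ≤ B x y :=
  (h.mem_cone_iff x).1 hx y hy

theorem apply_sum (h : S.IsSpectral B I) {s : Finset A} (hs : S.IsOrthoPure B s) (l : A → ℝ)
    {φ : A} (hφ : φ ∈ s) : B (∑ ω ∈ s, l ω • ω) φ = l φ := by
  rw [map_sum, LinearMap.sum_apply, Finset.sum_eq_single φ]
  · simp [h.pure_self φ (hs.1 φ hφ)]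
  · intro ω hω hne
    simp [hs.2 ω hω φ hφ hne]
  · exact fun hn => absurd hφ hn

theorem apply_sum_one (h : S.IsSpectral B I) {s : Finset A} (hs : S.IsOrthoPure B s)
    {φ : A} (hφ : φ ∈ s) : B (∑ ω ∈ s, ω) φ = 1 := by
  simpa using h.apply_sum hs (fun _ => 1) hφ

theorem unit_eq_sum (h : S.IsSpectral B I) {t : Finset A} (ht : ∑ ω ∈ t, ω = I) (x : A) :
    S.unit x = ∑ ω ∈ t, B ω x := by
  rw [← h.apply_one, ← ht, map_sum, LinearMap.sum_apply]

theorem apply_le_unit_of_pure (h : S.IsSpectral B I) {ω : A} (hω : S.IsPure ω) {x : A}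
    (hx : x ∈ S.cone) : B ω x ≤ S.unit x := by
  obtain ⟨t, hst, ht, hI⟩ := h.extend _ (isOrthoPure_singleton hω)
  rw [h.unit_eq_sum hI]
  exact Finset.single_le_sum (f := fun ω => B ω x)
    (fun φ hφ => h.nonneg (ht.1 φ hφ).mem_cone hx) (hst (Finset.mem_singleton_self ω))

/-- Each pure effect is at most `u`; sum along the spectral decomposition of `x`. For `x = y` this
reads `‖x‖ ≤ u x`, the inequality that detects non-purity later. -/
theorem apply_le_mul_unit (h : S.IsSpectral B I) {x y : A} (hx : x ∈ S.cone)
    (hy : y ∈ S.cone) : B x y ≤ S.unit x * S.unit y := by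
  obtain ⟨s, l, hs, hl, rfl⟩ := h.decomp x hx
  rw [map_sum, map_sum, LinearMap.sum_apply, Finset.sum_mul]
  refine Finset.sum_le_sum fun ω hω => ?_
  rw [map_smul, map_smul, LinearMap.smul_apply, (hs.1 ω hω).unit_eq, smul_eq_mul, smul_eq_mul,
    mul_one]
  exact mul_le_mul_of_nonneg_left (h.apply_le_unit_of_pure (hs.1 ω hω) hy) (hl ω hω).le

theorem isProj_compl (h : S.IsSpectral B I) {p : A} (hp : S.IsProj B p) :
    S.IsProj B (I - p) := by
  classical
  obtain ⟨s, hs, rfl⟩ := hp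
  obtain ⟨t, hst, ht, hI⟩ := h.extend s hs
  exact ⟨t \ s, ht.mono Finset.sdiff_subset, by
    rw [← hI, ← Finset.sum_sdiff hst, add_sub_cancel_right]⟩

theorem isProj_one (h : S.IsSpectral B I) : S.IsProj B I := by
  simpa using h.isProj_compl isProj_zero

theorem apply_self_of_isProj (h : S.IsSpectral B I) {p : A} (hp : S.IsProj B p) :
    B p p = S.unit p := by
  obtain ⟨s, hs, rfl⟩ := hp
  rw [map_sum (B (∑ ω ∈ s, ω)), map_sum S.unit]
  exact Finset.sum_congr rfl fun ω hω => by rw [h.apply_sum_one hs hω, (hs.1 ω hω).unit_eq]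

theorem apply_le_unit (h : S.IsSpectral B I) {p : A} (hp : S.IsProj B p) {x : A}
    (hx : x ∈ S.cone) : B x p ≤ S.unit x := by
  have := h.nonneg (h.isProj_compl hp).mem_cone hx
  rw [map_sub, LinearMap.sub_apply, h.apply_one, h.symm p] at this
  linarith

theorem apply_eq_zero_of_mem (h : S.IsSpectral B I) {s : Finset A} (hs : S.IsOrthoPure B s)
    {x : A} (hx : x ∈ S.cone) (h0 : B x (∑ ω ∈ s, ω) = 0) {ω : A} (hω : ω ∈ s) : B x ω = 0 := by
  rw [map_sum] at h0
  exact (Finset.sum_eq_zero_iff_of_nonneg fun φ hφ => h.nonneg hx (hs.1 φ hφ).mem_cone).1 h0 ω hω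

/-- Pairings in the cone are nonnegative, so `⟨p, q⟩ = 0` forces every pure component of `p` to be
orthogonal to every one of `q`. -/
theorem isProj_add (h : S.IsSpectral B I) {p q : A} (hp : S.IsProj B p) (hq : S.IsProj B q)
    (hpq : B p q = 0) : S.IsProj B (p + q) := by
  classical
  have hpc := hp.mem_cone
  obtain ⟨s, hs, rfl⟩ := hp
  obtain ⟨t, ht, rfl⟩ := hq
  have h0 : ∀ ω ∈ s, ∀ φ ∈ t, B ω φ = 0 := fun ω hω φ hφ => by
    rw [h.symm]
    refine h.apply_eq_zero_of_mem hs (ht.1 φ hφ).mem_cone ?_ hω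
    rw [h.symm]
    exact h.apply_eq_zero_of_mem ht hpc hpq hφ
  refine ⟨s ∪ t, hs.union h.symm ht h0, (Finset.sum_union ?_).symm⟩
  refine Finset.disjoint_left.2 fun ω h1 h2 => ?_
  have := h0 ω h1 ω h2
  rw [h.pure_self ω (hs.1 ω h1)] at this
  exact one_ne_zero this

theorem isProj_sum (h : S.IsSpectral B I) {ι : Type*} {p : ι → A} (hp : ∀ i, S.IsProj B (p i))
    (ho : ∀ i j, i ≠ j → B (p i) (p j) = 0) (J : Finset ι) : S.IsProj B (∑ i ∈ J, p i) := by
  classical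
  induction J using Finset.induction_on with
  | empty => simpa using isProj_zero
  | insert a J ha ih =>
    rw [Finset.sum_insert ha]
    refine h.isProj_add (hp a) ih ?_
    rw [map_sum]
    exact Finset.sum_eq_zero fun i hi => ho a i fun e => ha (e ▸ hi)

theorem mem_projFace_compl (h : S.IsSpectral B I) {p x : A} :
    x ∈ S.projFace B (I - p) ↔ x ∈ S.cone ∧ B x p = 0 := by
  refine and_congr_right fun _ => ?_
  rw [map_sub, h.symm x I, h.apply_one, sub_eq_self]

theorem self_mem_projFace (h : S.IsSpectral B I) {p : A} (hp : S.IsProj B p) :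
    p ∈ S.projFace B p :=
  ⟨hp.mem_cone, h.apply_self_of_isProj hp⟩

theorem mem_projFace_of_mem (h : S.IsSpectral B I) {s : Finset A} (hs : S.IsOrthoPure B s)
    {ω : A} (hω : ω ∈ s) : ω ∈ S.projFace B (∑ φ ∈ s, φ) :=
  ⟨(hs.1 ω hω).mem_cone, by rw [h.symm, h.apply_sum_one hs hω, (hs.1 ω hω).unit_eq]⟩

end IsSpectral

theorem zero_mem_projFace {S : OpSystem A} {B : LinearMap.BilinForm ℝ A} (p : A) :
    0 ∈ S.projFace B p :=
  ⟨S.zero_mem_cone, by simp⟩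

theorem add_mem_projFace {S : OpSystem A} {B : LinearMap.BilinForm ℝ A} {p x y : A}
    (hx : x ∈ S.projFace B p) (hy : y ∈ S.projFace B p) : x + y ∈ S.projFace B p :=
  ⟨S.add_mem_cone hx.1 hy.1, by simp [hx.2, hy.2]⟩

theorem smul_mem_projFace {S : OpSystem A} {B : LinearMap.BilinForm ℝ A} {p x : A} {r : ℝ}
    (hr : 0 ≤ r) (hx : x ∈ S.projFace B p) : r • x ∈ S.projFace B p :=
  ⟨S.smul_mem_cone hr hx.1, by simp [hx.2]⟩

theorem apply_eq_unit_of_mem_span {S : OpSystem A} {B : LinearMap.BilinForm ℝ A} {p x : A}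
    (hx : x ∈ Submodule.span ℝ (S.projFace B p)) : B x p = S.unit x := by
  induction hx using Submodule.span_induction with
  | mem x hx => exact hx.2
  | zero => simp
  | add x y _ _ hx hy => simp [hx, hy]
  | smul a x _ hx => simp [hx]

theorem mem_projFace_of_mem_span {S : OpSystem A} {B : LinearMap.BilinForm ℝ A} {p x : A}
    (hx : x ∈ Submodule.span ℝ (S.projFace B p)) (hc : x ∈ S.cone) : x ∈ S.projFace B p :=
  ⟨hc, apply_eq_unit_of_mem_span hx⟩

namespace IsSpectral

variable {S : OpSystem A} {B : LinearMap.BilinForm ℝ A} {I : A}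

theorem mem_of_add_mem_projFace (h : S.IsSpectral B I) {p x y : A} (hp : S.IsProj B p)
    (hx : x ∈ S.cone) (hy : y ∈ S.cone) (hxy : x + y ∈ S.projFace B p) :
    x ∈ S.projFace B p := by
  refine ⟨hx, ?_⟩
  have h1 := hxy.2
  simp only [map_add, LinearMap.add_apply] at h1
  linarith [h.apply_le_unit hp hx, h.apply_le_unit hp hy]

/-- Elements of `projFace p` decompose along orthogonal pure states with sum `p`. -/
theorem projFace_decomp (h : S.IsSpectral B I) {p x : A} (hp : S.IsProj B p)
    (hx : x ∈ S.projFace B p) : ∃ (s : Finset A) (l : A → ℝ), S.IsOrthoPure B s ∧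
      ∑ ω ∈ s, ω = p ∧ (∀ ω ∈ s, 0 ≤ l ω) ∧ x = ∑ ω ∈ s, l ω • ω := by
  classical
  obtain ⟨s, l, hs, hl, e⟩ := h.decomp x hx.1
  obtain ⟨t, ht, hpt⟩ := h.isProj_compl hp
  have hxt : B x (∑ ω ∈ t, ω) = 0 := by
    rw [← hpt, map_sub, hx.2, h.symm, h.apply_one, sub_self]
  have h0 : ∀ ω ∈ s, ∀ φ ∈ t, B ω φ = 0 := by
    intro ω hω φ hφ
    have h1 := h.apply_eq_zero_of_mem ht hx.1 hxt hφ
    rw [e, map_sum, LinearMap.sum_apply] at h1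
    have h2 := (Finset.sum_eq_zero_iff_of_nonneg fun ω hω => ?_).1 h1 ω hω
    · rw [map_smul, LinearMap.smul_apply, smul_eq_mul] at h2
      exact (mul_eq_zero.1 h2).resolve_left (hl ω hω).ne'
    · rw [map_smul, LinearMap.smul_apply, smul_eq_mul]
      exact mul_nonneg (hl ω hω).le (h.nonneg (hs.1 ω hω).mem_cone (ht.1 φ hφ).mem_cone)
  -- The pure components `s` of `x` are orthogonal to the components `t` of `I - p`. Completing `s ∪
  -- t` to a family with sum `I` and removing `t` leaves a family with sum `p` that contains `s`;
  -- the added members get weight `0`.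
  obtain ⟨r, hr, hro, hI⟩ := h.extend _ (hs.union h.symm ht h0)
  have htr : t ⊆ r := Finset.subset_union_right.trans hr
  have hsr : s ⊆ r \ t := fun ω hω => Finset.mem_sdiff.2
    ⟨hr (Finset.mem_union_left _ hω), fun hωt => by
      have := h0 ω hω ω hωt
      rw [h.pure_self ω (hs.1 ω hω)] at this
      exact one_ne_zero this⟩
  refine ⟨r \ t, fun ω => if ω ∈ s then l ω else 0, hro.mono Finset.sdiff_subset, ?_, ?_, ?_⟩
  · have h3 := Finset.sum_sdiff (f := fun ω : A => ω) htr
    rw [hI, ← hpt] at h3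
    rw [eq_sub_of_add_eq h3]
    abel
  · intro ω _
    by_cases hω : ω ∈ s
    · simpa [hω] using (hl ω hω).le
    · simp [hω]
  · rw [e, ← Finset.sum_subset hsr fun ω _ hω => by simp [hω]]
    exact Finset.sum_congr rfl fun ω hω => by simp [hω]

theorem sub_mem_projFace (h : S.IsSpectral B I) {s : Finset A} (hs : S.IsOrthoPure B s)
    {l : A → ℝ} {t : ℝ} (hl : ∀ ω ∈ s, l ω ≤ t) :
    t • ∑ ω ∈ s, ω - ∑ ω ∈ s, l ω • ω ∈ S.projFace B (∑ ω ∈ s, ω) := by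
  have hd : t • ∑ ω ∈ s, ω - ∑ ω ∈ s, l ω • ω = ∑ ω ∈ s, (t - l ω) • ω := by
    rw [Finset.smul_sum, ← Finset.sum_sub_distrib]
    exact Finset.sum_congr rfl fun ω _ => (sub_smul _ _ _).symm
  rw [hd]
  refine ⟨S.sum_mem_cone _ fun ω hω =>
    S.smul_mem_cone (sub_nonneg.2 (hl ω hω)) (hs.1 ω hω).mem_cone, ?_⟩
  rw [h.symm, map_sum (B _), map_sum S.unit]
  exact Finset.sum_congr rfl fun ω hω => by
    rw [map_smul, map_smul, h.apply_sum_one hs hω, (hs.1 ω hω).unit_eq]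

theorem exists_smul_sub_mem_projFace (h : S.IsSpectral B I) {p x : A} (hp : S.IsProj B p)
    (hx : x ∈ S.projFace B p) : ∃ t : ℝ, 0 ≤ t ∧ t • p - x ∈ S.projFace B p := by
  obtain ⟨s, l, hs, rfl, hl, rfl⟩ := h.projFace_decomp hp hx
  exact ⟨∑ ω ∈ s, l ω, Finset.sum_nonneg hl, h.sub_mem_projFace hs fun ω hω =>
    Finset.single_le_sum hl hω⟩

/-- Within the span of its face, `p` plays the role of an order unit; as before, both signs are
needed for scalar multiples. -/
theorem exists_add_smul_mem_projFace (h : S.IsSpectral B I) {p x : A} (hp : S.IsProj B p)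
    (hx : x ∈ Submodule.span ℝ (S.projFace B p)) :
    ∃ t : ℝ, 0 ≤ t ∧ x + t • p ∈ S.projFace B p ∧ -x + t • p ∈ S.projFace B p := by
  induction hx using Submodule.span_induction with
  | mem x hx =>
    obtain ⟨t, ht, h1⟩ := h.exists_smul_sub_mem_projFace hp hx
    exact ⟨t, ht, add_mem_projFace hx (smul_mem_projFace ht (h.self_mem_projFace hp)),
      by rwa [neg_add_eq_sub]⟩
  | zero =>
    exact ⟨0, le_rfl, by simpa using zero_mem_projFace p, by simpa using zero_mem_projFace p⟩
  | add x y _ _ hx hy =>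
    obtain ⟨s, hs, hx1, hx2⟩ := hx
    obtain ⟨t, ht, hy1, hy2⟩ := hy
    refine ⟨s + t, add_nonneg hs ht, ?_, ?_⟩
    · convert add_mem_projFace hx1 hy1 using 1
      module
    · convert add_mem_projFace hx2 hy2 using 1
      module
  | smul a x _ hx =>
    obtain ⟨s, hs, hx1, hx2⟩ := hx
    refine ⟨|a| * s, by positivity, ?_, ?_⟩
    · rcases le_total 0 a with ha | ha
      · rw [abs_of_nonneg ha]
        convert smul_mem_projFace ha hx1 using 1
        module
      · rw [abs_of_nonpos ha]
        convert smul_mem_projFace (neg_nonneg.2 ha) hx2 using 1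
        module
    · rcases le_total 0 a with ha | ha
      · rw [abs_of_nonneg ha]
        convert smul_mem_projFace ha hx2 using 1
        module
      · rw [abs_of_nonpos ha]
        convert smul_mem_projFace (neg_nonneg.2 ha) hx1 using 1
        module

theorem span_projFace_decomp (h : S.IsSpectral B I) {p x : A} (hp : S.IsProj B p)
    (hx : x ∈ Submodule.span ℝ (S.projFace B p)) : ∃ (s : Finset A) (l : A → ℝ),
      S.IsOrthoPure B s ∧ ∑ ω ∈ s, ω = p ∧ x = ∑ ω ∈ s, l ω • ω := by
  obtain ⟨t, -, h1, -⟩ := h.exists_add_smul_mem_projFace hp hx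
  obtain ⟨s, l, hs, hsp, -, e⟩ := h.projFace_decomp hp h1
  refine ⟨s, fun ω => l ω - t, hs, hsp, ?_⟩
  rw [eq_sub_of_add_eq e, ← hsp, Finset.smul_sum, ← Finset.sum_sub_distrib]
  exact Finset.sum_congr rfl fun ω _ => (sub_smul _ _ _).symm

theorem apply_eq_zero_of_mem_projFace (h : S.IsSpectral B I) {p x y : A} (hp : S.IsProj B p)
    (hx : x ∈ S.projFace B p) (hy : y ∈ S.cone) (hyp : B y p = 0) : B x y = 0 := by
  obtain ⟨s, l, hs, rfl, hl, rfl⟩ := h.projFace_decomp hp hx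
  rw [h.symm, map_sum]
  exact Finset.sum_eq_zero fun ω hω => by
    rw [map_smul, h.apply_eq_zero_of_mem hs hy hyp hω, smul_zero]

end IsSpectral

/-! ### Orthogonal projections onto faces -/

/-- `P` is the orthogonal projection onto `W` with respect to `B`. -/
def IsOrthProj (B : LinearMap.BilinForm ℝ A) (W : Submodule ℝ A) (P : A →ₗ[ℝ] A) : Prop :=
  ∀ x, P x ∈ W ∧ ∀ y ∈ W, B (P x) y = B x y

theorem eq_of_forall_apply_eq {V : Type*} [AddCommGroup V] [Module ℝ V]
    {B : LinearMap.BilinForm ℝ V} (hp : ∀ x, x ≠ 0 → 0 < B x x) {W : Submodule ℝ V} {x y : V}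
    (hx : x ∈ W) (hy : y ∈ W) (h : ∀ z ∈ W, B x z = B y z) :
    x = y := by
  by_contra hne
  have := hp _ (sub_ne_zero.2 hne)
  rw [LinearMap.map_sub₂, h _ (W.sub_mem hx hy), sub_self] at this
  exact lt_irrefl _ this

theorem exists_isOrthProj {B : LinearMap.BilinForm ℝ A} (hp : ∀ x, x ≠ 0 → 0 < B x x)
    (W : Submodule ℝ A) : ∃ P, IsOrthProj B W P := by
  have hW : ∀ x : W, x ≠ 0 → 0 < (B.restrict W) x x := fun x hx => hp x (by simpa using hx)
  have key : ∀ x, ∃ a ∈ W, ∀ y ∈ W, B a y = B x y := fun x => by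
    obtain ⟨a, ha⟩ := exists_riesz hW (B x ∘ₗ W.subtype)
    exact ⟨a, a.2, fun y hy => ha ⟨y, hy⟩⟩
  choose P hPW hP using key
  refine ⟨⟨⟨P, fun x y => ?_⟩, fun c x => ?_⟩, fun x => ⟨hPW x, hP x⟩⟩
  · refine eq_of_forall_apply_eq hp (hPW _) (W.add_mem (hPW x) (hPW y)) fun z hz => ?_
    simp [hP _ z hz]
  · refine eq_of_forall_apply_eq hp (hPW _) (W.smul_mem c (hPW x)) fun z hz => ?_
    simp [hP _ z hz]

namespace IsSpectral

variable {S : OpSystem A} {B : LinearMap.BilinForm ℝ A} {I : A}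

/-- The orthogonal projection onto the span of `projFace p`. -/
noncomputable def proj (h : S.IsSpectral B I) (p : A) : A →ₗ[ℝ] A :=
  Classical.choose (exists_isOrthProj h.pos (Submodule.span ℝ (S.projFace B p)))

theorem isOrthProj_proj (h : S.IsSpectral B I) (p : A) :
    IsOrthProj B (Submodule.span ℝ (S.projFace B p)) (h.proj p) :=
  Classical.choose_spec (exists_isOrthProj h.pos (Submodule.span ℝ (S.projFace B p)))

theorem proj_mem_span (h : S.IsSpectral B I) (p x : A) :
    h.proj p x ∈ Submodule.span ℝ (S.projFace B p) :=
  (h.isOrthProj_proj p x).1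

theorem apply_proj_of_mem (h : S.IsSpectral B I) {p y : A} (x : A)
    (hy : y ∈ Submodule.span ℝ (S.projFace B p)) : B (h.proj p x) y = B x y :=
  (h.isOrthProj_proj p x).2 y hy

theorem proj_symm (h : S.IsSpectral B I) (p x y : A) : B (h.proj p x) y = B x (h.proj p y) := by
  rw [h.symm, ← h.apply_proj_of_mem y (h.proj_mem_span p x), h.symm,
    h.apply_proj_of_mem x (h.proj_mem_span p y)]

theorem proj_eq_self (h : S.IsSpectral B I) {p x : A}
    (hx : x ∈ Submodule.span ℝ (S.projFace B p)) : h.proj p x = x :=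
  eq_of_forall_apply_eq h.pos (h.proj_mem_span p x) hx fun _ hz => h.apply_proj_of_mem x hz

theorem proj_proj (h : S.IsSpectral B I) (p x : A) : h.proj p (h.proj p x) = h.proj p x :=
  h.proj_eq_self (h.proj_mem_span p x)

theorem proj_eq_zero (h : S.IsSpectral B I) {p x : A} (hp : S.IsProj B p) (hx : x ∈ S.cone)
    (h0 : B x p = 0) : h.proj p x = 0 := by
  refine eq_of_forall_apply_eq h.pos (h.proj_mem_span p x) (Submodule.zero_mem _) fun z hz => ?_
  rw [h.apply_proj_of_mem x hz, map_zero, LinearMap.zero_apply]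
  induction hz using Submodule.span_induction with
  | mem z hz => rw [h.symm, h.apply_eq_zero_of_mem_projFace hp hz hx h0]
  | zero => simp
  | add x y _ _ hx hy => simp [hx, hy]
  | smul a x _ hx => simp [hx]

/-- Orthogonal projections onto faces are positive. -/
theorem proj_mem_projFace (h : S.IsSpectral B I) {p x : A} (hp : S.IsProj B p)
    (hx : x ∈ S.cone) : h.proj p x ∈ S.projFace B p := by
  refine mem_projFace_of_mem_span (h.proj_mem_span p x) ?_
  -- Diagonalize the projected vector inside the face. Each coefficient is its pairing with some `ω`
  -- in the face, hence equals `⟨x, ω⟩ ≥ 0`.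
  obtain ⟨s, l, hs, hsp, e⟩ := h.span_projFace_decomp hp (h.proj_mem_span p x)
  rw [e]
  refine S.sum_mem_cone _ fun ω hω => S.smul_mem_cone ?_ (hs.1 ω hω).mem_cone
  have h1 : B (h.proj p x) ω = l ω := by rw [e, h.apply_sum hs l hω]
  rw [← h1, h.apply_proj_of_mem x (Submodule.subset_span (hsp ▸ h.mem_projFace_of_mem hs hω))]
  exact h.nonneg hx (hs.1 ω hω).mem_cone

theorem apply_proj_self (h : S.IsSpectral B I) {p : A} (hp : S.IsProj B p) (x : A) :
    B (h.proj p x) p = B x p :=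
  h.apply_proj_of_mem x (Submodule.subset_span (h.self_mem_projFace hp))

theorem unit_proj (h : S.IsSpectral B I) {p : A} (hp : S.IsProj B p) (x : A) :
    S.unit (h.proj p x) = B x p := by
  rw [← apply_eq_unit_of_mem_span (h.proj_mem_span p x), h.apply_proj_self hp]

theorem unit_proj_le (h : S.IsSpectral B I) {p x : A} (hp : S.IsProj B p) (hx : x ∈ S.cone) :
    S.unit (h.proj p x) ≤ S.unit x := by
  rw [h.unit_proj hp]
  exact h.apply_le_unit hp hx

end IsSpectral

end OpSystem
end OPT

namespace OPT

/-! ### Complemented projections under linear equivalences -/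

/-- This carries complementedness between `A` and its dual along the inner product, under which the
dual of a map becomes its adjoint. -/
theorem IsComplemented.conj {V W : Type*} [AddCommGroup V] [Module ℝ V] [AddCommGroup W]
    [Module ℝ W] (e : V ≃ₗ[ℝ] W) {K : Set V} {K' : Set W} (hK : ∀ x, e x ∈ K' ↔ x ∈ K)
    {P : V →ₗ[ℝ] V} {P' : W →ₗ[ℝ] W} (hP : ∀ x, P' (e x) = e (P x))
    (h : IsComplemented K P) : IsComplemented K' P' := by
  have hrange : ∀ {R : V →ₗ[ℝ] V} {R' : W →ₗ[ℝ] W}, (∀ x, R' (e x) = e (R x)) →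
      ∀ x, e x ∈ LinearMap.range R' ↔ x ∈ LinearMap.range R := by
    intro R R' hR x
    constructor
    · rintro ⟨y, hy⟩
      exact ⟨e.symm y, e.injective (by rw [← hR, e.apply_symm_apply, hy])⟩
    · rintro ⟨y, rfl⟩
      exact ⟨e y, hR y⟩
  have hker : ∀ {R : V →ₗ[ℝ] V} {R' : W →ₗ[ℝ] W}, (∀ x, R' (e x) = e (R x)) →
      ∀ x, e x ∈ LinearMap.ker R' ↔ x ∈ LinearMap.ker R := by
    intro R R' hR x
    rw [LinearMap.mem_ker, LinearMap.mem_ker, hR, e.map_eq_zero_iff]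
  obtain ⟨Q, ⟨hQ1, hQ2⟩, h1, h2⟩ := h
  let Q' : W →ₗ[ℝ] W := e.toLinearMap ∘ₗ Q ∘ₗ e.symm.toLinearMap
  have hQ : ∀ x, Q' (e x) = e (Q x) := fun x => by simp [Q']
  refine ⟨Q', ⟨?_, fun y hy => ?_⟩, ?_, ?_⟩
  · ext y
    have := DFunLike.congr_fun hQ1 (e.symm y)
    simpa [Q'] using this
  · obtain ⟨x, rfl⟩ := e.surjective y
    rw [hQ, hK]
    exact hQ2 x ((hK x).1 hy)
  · ext y
    obtain ⟨x, rfl⟩ := e.surjective y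
    have := Set.ext_iff.1 h1 x
    simpa only [Set.mem_inter_iff, SetLike.mem_coe, hK, hrange hP, hker hQ] using this
  · ext y
    obtain ⟨x, rfl⟩ := e.surjective y
    have := Set.ext_iff.1 h2 x
    simpa only [Set.mem_inter_iff, SetLike.mem_coe, hK, hrange hQ, hker hP] using this

namespace OpSystem

variable {A : Type*} [NormedAddCommGroup A] [NormedSpace ℝ A] [FiniteDimensional ℝ A]

/-! ### Faces of the cone -/

theorem IsFace.smul_mem {S : OpSystem A} {F : Set A} (hF : S.IsFace F) {r : ℝ} (hr : 0 ≤ r)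
    {x : A} (hx : x ∈ F) : r • x ∈ F := by
  have hxc := hF.2.2.subset hx
  -- The point `x` lies strictly between `r • x` and `(2 / (r + 1)) • x`, with weights `1 / (r + 2)`
  -- and `(r + 1) / (r + 2)`.
  refine hF.2.2.left_mem_of_mem_openSegment (S.smul_mem_cone hr hxc)
    (S.smul_mem_cone (r := 2 / (r + 1)) (by positivity) hxc) hx
    ⟨1 / (r + 2), (r + 1) / (r + 2), by positivity, by positivity, by field_simp; ring, ?_⟩
  rw [smul_smul, smul_smul, ← add_smul]
  have : 1 / (r + 2) * r + (r + 1) / (r + 2) * (2 / (r + 1)) = 1 := by field_simp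
  rw [this, one_smul]

theorem IsFace.zero_mem {S : OpSystem A} {F : Set A} (hF : S.IsFace F) : (0 : A) ∈ F := by
  obtain ⟨x, hx⟩ := hF.1
  simpa using hF.smul_mem le_rfl hx

theorem IsFace.add_mem {S : OpSystem A} {F : Set A} (hF : S.IsFace F) {x y : A} (hx : x ∈ F)
    (hy : y ∈ F) : x + y ∈ F := by
  have := hF.smul_mem zero_le_two (hF.2.1 hx hy (by norm_num : (0 : ℝ) ≤ 1 / 2)
    (by norm_num : (0 : ℝ) ≤ 1 / 2) (by norm_num))
  rwa [smul_add, smul_smul, smul_smul, mul_one_div_cancel two_ne_zero, one_smul, one_smul] at this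

theorem IsFace.sum_mem {S : OpSystem A} {F : Set A} (hF : S.IsFace F) {ι : Type*}
    (s : Finset ι) {f : ι → A} (h : ∀ i ∈ s, f i ∈ F) : ∑ i ∈ s, f i ∈ F := by
  classical
  induction s using Finset.induction_on with
  | empty => simpa using hF.zero_mem
  | insert a s ha ih =>
    rw [Finset.sum_insert ha]
    exact hF.add_mem (h a (by simp)) (ih fun i hi => h i (by simp [hi]))

theorem IsFace.mem_of_add_mem {S : OpSystem A} {F : Set A} (hF : S.IsFace F) {x y : A}
    (hx : x ∈ S.cone) (hy : y ∈ S.cone) (h : x + y ∈ F) : x ∈ F := by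
  have h2 : (2 : ℝ) • x ∈ F := by
    refine hF.2.2.left_mem_of_mem_openSegment (S.smul_mem_cone zero_le_two hx)
      (S.smul_mem_cone zero_le_two hy) h
      ⟨1 / 2, 1 / 2, by norm_num, by norm_num, by norm_num, ?_⟩
    rw [smul_smul, smul_smul, one_div_mul_cancel two_ne_zero, one_smul, one_smul]
  have := hF.smul_mem (r := 1 / 2) (by norm_num) h2
  rwa [smul_smul, one_div_mul_cancel two_ne_zero, one_smul] at this

theorem isFace_of_add {S : OpSystem A} {F : Set A} (hF : F ⊆ S.cone) (h0 : (0 : A) ∈ F)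
    (hadd : ∀ x ∈ F, ∀ y ∈ F, x + y ∈ F) (hsmul : ∀ r : ℝ, 0 ≤ r → ∀ x ∈ F, r • x ∈ F)
    (hsub : ∀ x ∈ S.cone, ∀ y ∈ S.cone, x + y ∈ F → x ∈ F) : S.IsFace F := by
  refine ⟨⟨0, h0⟩, fun x hx y hy a b ha hb _ => hadd _ (hsmul a ha x hx) _ (hsmul b hb y hy),
    hF, ?_⟩
  rintro x hx y hy z hz ⟨a, b, ha, hb, -, rfl⟩
  have := hsmul a⁻¹ (inv_nonneg.2 ha.le) _
    (hsub _ (S.smul_mem_cone ha.le hx) _ (S.smul_mem_cone hb.le hy) hz)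
  rwa [smul_smul, inv_mul_cancel₀ ha.ne', one_smul] at this

/-- The positive part of the kernel of a positive map is a face. -/
theorem isFace_ker_inter_cone {S : OpSystem A} {Q : A →ₗ[ℝ] A} (hQ : ∀ x ∈ S.cone, Q x ∈ S.cone) :
    S.IsFace ((LinearMap.ker Q : Set A) ∩ S.cone) := by
  refine isFace_of_add Set.inter_subset_right ⟨by simp, S.zero_mem_cone⟩ ?_ ?_ ?_
  · rintro x ⟨hx, hxc⟩ y ⟨hy, hyc⟩
    exact ⟨Submodule.add_mem _ hx hy, S.add_mem_cone hxc hyc⟩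
  · rintro r hr x ⟨hx, hxc⟩
    exact ⟨Submodule.smul_mem _ r hx, S.smul_mem_cone hr hxc⟩
  · rintro x hx y hy ⟨h, -⟩
    refine ⟨LinearMap.mem_ker.2 (S.eq_zero_of_unit_eq_zero (hQ x hx) ?_), hx⟩
    have h1 := congrArg S.unit (LinearMap.mem_ker.1 h)
    rw [map_add, map_add, map_zero] at h1
    linarith [S.unit_nonneg (hQ x hx), S.unit_nonneg (hQ y hy)]

namespace IsSpectral

variable {S : OpSystem A} {B : LinearMap.BilinForm ℝ A} {I : A}

theorem isFace_projFace (h : S.IsSpectral B I) {p : A} (hp : S.IsProj B p) :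
    S.IsFace (S.projFace B p) :=
  isFace_of_add (fun _ hx => hx.1) (zero_mem_projFace p) (fun _ hx _ hy => add_mem_projFace hx hy)
    (fun _ hr _ hx => smul_mem_projFace hr hx)
    fun _ hx _ hy hxy => h.mem_of_add_mem_projFace hp hx hy hxy

theorem projFace_subset (h : S.IsSpectral B I) {p : A} (hp : S.IsProj B p) {F : Set A}
    (hF : S.IsFace F) (hpF : p ∈ F) : S.projFace B p ⊆ F := by
  intro x hx
  obtain ⟨t, ht, h1⟩ := h.exists_smul_sub_mem_projFace hp hx
  refine hF.mem_of_add_mem hx.1 h1.1 ?_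
  rw [add_sub_cancel]
  exact hF.smul_mem ht hpF

theorem eq_of_apply_eq_unit (h : S.IsSpectral B I) {p q : A} (hp : S.IsProj B p)
    (hq : S.IsProj B q) (hpq : B p q = S.unit p) (hle : S.unit q ≤ S.unit p) : p = q := by
  by_contra hne
  have := h.pos _ (sub_ne_zero.2 hne)
  simp only [map_sub, LinearMap.sub_apply, h.apply_self_of_isProj hp, h.apply_self_of_isProj hq,
    h.symm q p, hpq] at this
  linarith

/-- Every face of the cone is of the form `projFace p`. -/
theorem exists_eq_projFace (h : S.IsSpectral B I) {F : Set A} (hF : S.IsFace F) :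
    ∃ p, S.IsProj B p ∧ F = S.projFace B p := by
  classical
  have hcard : ∀ s, S.IsOrthoPure B s → S.unit (∑ ω ∈ s, ω) = s.card := fun s hs => by
    rw [map_sum, Finset.sum_congr rfl fun ω hω => (hs.1 ω hω).unit_eq]
    simp
  -- Take an orthogonal pure family in `F` of maximal cardinality; `u I` bounds the cardinality.
  let R : ℕ → Prop := fun n => ∃ s, S.IsOrthoPure B s ∧ ∑ ω ∈ s, ω ∈ F ∧ s.card = n
  have hbound : ∀ n, R n → n ≤ ⌊S.unit I⌋₊ := by
    rintro n ⟨s, hs, -, rfl⟩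
    refine Nat.le_floor ?_
    rw [← hcard s hs]
    have := S.unit_nonneg (h.isProj_compl ⟨s, hs, rfl⟩).mem_cone
    rw [map_sub] at this
    linarith
  have hR0 : R 0 := ⟨∅, ⟨by simp, by simp⟩, by simpa using hF.zero_mem, rfl⟩
  obtain ⟨s, hs, hsF, hcs⟩ := Nat.findGreatest_spec (P := R) (Nat.zero_le _) hR0
  have hmax : ∀ n, R n → n ≤ s.card := fun n hn => hcs ▸ Nat.le_findGreatest (hbound n hn) hn
  have hp : S.IsProj B (∑ ω ∈ s, ω) := ⟨s, hs, rfl⟩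
  refine ⟨∑ ω ∈ s, ω, hp, Set.Subset.antisymm (fun y hy => ?_) (h.projFace_subset hp hF hsF)⟩
  have hyc := hF.2.2.subset hy
  have hpy := hF.add_mem hsF hy
  obtain ⟨t, l, ht, hl, e⟩ := h.decomp _ (hF.2.2.subset hpy)
  have hcone : ∀ ω ∈ t, l ω • ω ∈ S.cone := fun ω hω =>
    S.smul_mem_cone (hl ω hω).le (ht.1 ω hω).mem_cone
  have htF : ∑ ω ∈ t, ω ∈ F := by
    refine hF.sum_mem _ fun ω hω => ?_
    have h1 : l ω • ω ∈ F := by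
      refine hF.mem_of_add_mem (hcone ω hω)
        (S.sum_mem_cone (t.erase ω) fun φ hφ => hcone φ (Finset.mem_of_mem_erase hφ)) ?_
      rw [Finset.add_sum_erase t (fun ω => l ω • ω) hω, ← e]
      exact hpy
    have := hF.smul_mem (inv_nonneg.2 (hl ω hω).le) h1
    rwa [smul_smul, inv_mul_cancel₀ (hl ω hω).ne', one_smul] at this
  have hq : S.IsProj B (∑ ω ∈ t, ω) := ⟨t, ht, rfl⟩
  -- With `p` and `q` the sums over `s` and `t`, the vector `p + y` and hence `p` lie in the face of
  -- `q`. Maximality gives `u q ≤ u p`, so `‖p - q‖² = u q - u p ≤ 0` and `p = q`; then `y` is in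
  -- the face of `p`.
  have hmem : ∑ ω ∈ s, ω + y ∈ S.projFace B (∑ ω ∈ t, ω) := by
    rw [e]
    exact (h.isFace_projFace hq).sum_mem _ fun ω hω =>
      smul_mem_projFace (hl ω hω).le (h.mem_projFace_of_mem ht hω)
  have h1 := h.mem_of_add_mem_projFace hq hp.mem_cone hyc hmem
  have hle : S.unit (∑ ω ∈ t, ω) ≤ S.unit (∑ ω ∈ s, ω) := by
    rw [hcard t ht, hcard s hs]
    exact Nat.cast_le.2 (hmax _ ⟨t, ht, htF, rfl⟩)
  rw [h.eq_of_apply_eq_unit hp hq h1.2 hle]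
  rw [add_comm] at hmem
  exact h.mem_of_add_mem_projFace hq hyc hp.mem_cone hmem

theorem complFace_projFace (h : S.IsSpectral B I) {p : A} (hp : S.IsProj B p) :
    S.complFace B (S.projFace B p) = S.projFace B (I - p) := by
  ext x
  rw [h.mem_projFace_compl]
  refine and_congr_right fun hx => ⟨fun h1 => ?_, fun h1 y hy => ?_⟩
  · rw [h.symm]
    exact h1 p (h.self_mem_projFace hp)
  · exact h.apply_eq_zero_of_mem_projFace hp hy hx h1

theorem faceJoin_projFace (h : S.IsSpectral B I) {M : ℕ} {p : Fin M → A}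
    (hp : ∀ i, S.IsProj B (p i)) (ho : ∀ i j, i ≠ j → B (p i) (p j) = 0) (J : Finset (Fin M)) :
    S.faceJoin (fun i => S.projFace B (p i)) J = S.projFace B (∑ i ∈ J, p i) := by
  have hJ := h.isProj_sum hp ho J
  have hface := h.isFace_projFace hJ
  apply Set.Subset.antisymm
  · refine Set.sInter_subset_of_mem ⟨hface, Set.iUnion₂_subset fun i hi => ?_⟩
    refine h.projFace_subset (hp i) hface ⟨(hp i).mem_cone, ?_⟩
    rw [map_sum, Finset.sum_eq_single i (fun j _ hj => ho i j hj.symm) fun hn => absurd hi hn,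
      h.apply_self_of_isProj (hp i)]
  · refine Set.subset_sInter ?_
    rintro G ⟨hG, hsub⟩
    exact h.projFace_subset hJ hG (hG.sum_mem _ fun i hi =>
      hsub (Set.mem_biUnion hi (h.self_mem_projFace (hp i))))

/-! ### Filters are the orthogonal projections onto faces -/

theorem range_proj_inter_cone (h : S.IsSpectral B I) (p : A) :
    (LinearMap.range (h.proj p) : Set A) ∩ S.cone = S.projFace B p := by
  ext x
  constructor
  · rintro ⟨⟨y, rfl⟩, hx⟩
    exact mem_projFace_of_mem_span (h.proj_mem_span p y) hx
  · intro hx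
    exact ⟨⟨x, h.proj_eq_self (Submodule.subset_span hx)⟩, hx.1⟩

theorem ker_proj_inter_cone (h : S.IsSpectral B I) {p : A} (hp : S.IsProj B p) :
    (LinearMap.ker (h.proj p) : Set A) ∩ S.cone = S.projFace B (I - p) := by
  ext x
  rw [h.mem_projFace_compl]
  constructor
  · rintro ⟨h1, hx⟩
    refine ⟨hx, ?_⟩
    rw [← h.unit_proj hp, LinearMap.mem_ker.1 h1, map_zero]
  · rintro ⟨hx, h1⟩
    exact ⟨LinearMap.mem_ker.2 (h.proj_eq_zero hp hx h1), hx⟩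

theorem isComplemented_proj (h : S.IsSpectral B I) {p : A} (hp : S.IsProj B p) :
    IsComplemented S.cone (h.proj p) := by
  have hq := h.isProj_compl hp
  refine ⟨h.proj (I - p), ⟨LinearMap.ext fun _ => h.proj_proj _ _,
    fun _ hx => (h.proj_mem_projFace hq hx).1⟩, ?_, ?_⟩
  · rw [h.range_proj_inter_cone, h.ker_proj_inter_cone hq, sub_sub_cancel]
  · rw [h.range_proj_inter_cone, h.ker_proj_inter_cone hp]

/-- The identification of the space with its dual. -/
noncomputable def toDual (h : S.IsSpectral B I) : A ≃ₗ[ℝ] Module.Dual ℝ A :=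
  LinearEquiv.ofBijective B ⟨(injective_iff_map_eq_zero B).2 fun x hx => by
    by_contra hne
    have := h.pos x hne
    rw [hx, LinearMap.zero_apply] at this
    exact lt_irrefl _ this,
    fun f => (exists_riesz h.pos f).imp fun _ ha => LinearMap.ext ha⟩

theorem toDual_apply (h : S.IsSpectral B I) (x y : A) : h.toDual x y = B x y := rfl

theorem toDual_mem_dualCone_iff (h : S.IsSpectral B I) (x : A) :
    h.toDual x ∈ S.dualCone ↔ x ∈ S.cone :=
  (h.mem_cone_iff x).symm

theorem isFilter_proj (h : S.IsSpectral B I) {p : A} (hp : S.IsProj B p) :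
    S.IsFilter (h.proj p) where
  posProj := ⟨LinearMap.ext fun _ => h.proj_proj _ _, fun _ hx => (h.proj_mem_projFace hp hx).1⟩
  complemented := h.isComplemented_proj hp
  dual_complemented := (h.isComplemented_proj hp).conj h.toDual h.toDual_mem_dualCone_iff
    fun x => LinearMap.ext fun y => (h.proj_symm p x y).symm
  normalized _ hx := h.unit_proj_le hp hx

/-- The positive part of the image of a complemented positive projection is a face which spans
the image. -/
theorem exists_range_eq_span (h : S.IsSpectral B I) {P : A →ₗ[ℝ] A}
    (hP : ∀ x ∈ S.cone, P x ∈ S.cone) (hc : IsComplemented S.cone P) :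
    ∃ p, S.IsProj B p ∧ (LinearMap.range P : Set A) ∩ S.cone = S.projFace B p ∧
      LinearMap.range P = Submodule.span ℝ (S.projFace B p) := by
  obtain ⟨Q, hQ, h1, -⟩ := hc
  -- Complementedness enters here: the positive part of the image of `P` equals that of the kernel
  -- of `Q`, which is a face.
  obtain ⟨p, hp, hF⟩ := h.exists_eq_projFace (isFace_ker_inter_cone hQ.2)
  rw [← h1] at hF
  refine ⟨p, hp, hF, le_antisymm ?_ ?_⟩
  · rw [LinearMap.range_eq_map, ← S.span_cone, Submodule.map_span]
    refine Submodule.span_mono ?_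
    rintro _ ⟨x, hx, rfl⟩
    rw [← hF]
    exact ⟨⟨x, rfl⟩, hP x hx⟩
  · rw [← hF]
    exact Submodule.span_le.2 Set.inter_subset_left

/-- The spectral coefficients of `x` are its pairings with pure states, so all are at most `1`,
while `r` has all coefficients equal to `1` along the same family. -/
theorem sub_mem_cone_of_mem_projFace (h : S.IsSpectral B I) {r x : A} (hr : S.IsProj B r)
    (hx : x ∈ S.projFace B r) (hle : ∀ ω, S.IsPure ω → B x ω ≤ 1) :
    r - x ∈ S.projFace B r := by
  obtain ⟨s, l, hs, rfl, -, rfl⟩ := h.projFace_decomp hr hx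
  have := h.sub_mem_projFace hs (l := l) (t := 1) fun ω hω => by
    rw [← h.apply_sum hs l hω]
    exact hle ω (hs.1 ω hω)
  rwa [one_smul] at this

/-- Filters are the orthogonal projections onto the faces. -/
theorem exists_eq_proj_of_isFilter (h : S.IsSpectral B I) {P : A →ₗ[ℝ] A} (hP : S.IsFilter P) :
    ∃ p, S.IsProj B p ∧ P = h.proj p := by
  -- `P'` is the adjoint of `P`. The images of `P` and `P'` are spanned by faces with units `p` and
  -- `r`; the aim is `p = r`, so that `P` and `P'` have the same image.
  let P' : A →ₗ[ℝ] A := h.toDual.symm.toLinearMap ∘ₗ P.dualMap ∘ₗ h.toDual.toLinearMap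
  have hadj : ∀ x y, B (P' x) y = B x (P y) := fun x y => by
    rw [← h.toDual_apply]
    simp only [P', LinearMap.comp_apply, LinearEquiv.coe_coe, LinearEquiv.apply_symm_apply]
    rfl
  have hPidem : ∀ x, P (P x) = P x := fun x => DFunLike.congr_fun hP.posProj.1 x
  have hP'idem : ∀ x, P' (P' x) = P' x := fun x => by
    refine eq_of_forall_apply_eq h.pos (W := ⊤) trivial trivial fun z _ => ?_
    rw [hadj, hadj, hadj, hPidem]
  have hP'pos : ∀ x ∈ S.cone, P' x ∈ S.cone := fun x hx => (h.mem_cone_iff _).2 fun y hy => by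
    rw [hadj]
    exact h.nonneg hx (hP.posProj.2 y hy)
  have hP'c : IsComplemented S.cone P' := by
    refine hP.dual_complemented.conj h.toDual.symm (fun f => ?_) fun f => ?_
    · rw [← h.toDual_mem_dualCone_iff, LinearEquiv.apply_symm_apply]
    · simp [P']
  obtain ⟨p, hp, hpF, hprange⟩ := h.exists_range_eq_span hP.posProj.2 hP.complemented
  obtain ⟨r, hr, hrF, hrrange⟩ := h.exists_range_eq_span hP'pos hP'c
  have hPp : P p = p := by
    have : p ∈ LinearMap.range P := (hpF ▸ h.self_mem_projFace hp : p ∈ _ ∩ S.cone).1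
    obtain ⟨y, hy⟩ := this
    rw [← hy, hPidem]
  have hIc := h.isProj_one.mem_cone
  have hPI : P' I ∈ S.projFace B r := hrF ▸ ⟨⟨I, rfl⟩, hP'pos I hIc⟩
  have hPI_le : ∀ x ∈ S.cone, B (P' I) x ≤ S.unit x := fun x hx => by
    rw [hadj, h.apply_one]
    exact hP.normalized x hx
  -- Normalization of `P` yields `P' I ≤ r`. Pairing with `p` gives `⟨r, p⟩ ≥ ⟨I, P p⟩ = u p`, so
  -- `p` lies in the face of `r`.
  have h1 := h.nonneg (h.sub_mem_cone_of_mem_projFace hr hPI fun ω hω =>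
    (hPI_le ω hω.mem_cone).trans_eq hω.unit_eq).1 hp.mem_cone
  rw [LinearMap.map_sub₂, hadj, hPp, h.apply_one] at h1
  have hpr : p ∈ S.projFace B r :=
    ⟨hp.mem_cone, le_antisymm (h.apply_le_unit hr hp.mem_cone) (by rw [h.symm]; linarith)⟩
  have hsub := h.sub_mem_cone_of_mem_projFace hr hpr fun ω hω => by
    rw [h.symm]
    exact (h.apply_le_unit hp hω.mem_cone).trans_eq hω.unit_eq
  have hfix : ∀ y ∈ LinearMap.range P', P' y = y := by
    rintro _ ⟨y, rfl⟩
    exact hP'idem y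
  -- The vector `r - p` is fixed by `P'`, yet it is orthogonal to the face of `p`, hence to the
  -- image of `P`. So `⟨r - p, z⟩ = ⟨r - p, P z⟩ = 0` for all `z`.
  have hrp : r - p = 0 := by
    have h2 : P' (r - p) = r - p := hfix _ (hrrange ▸ Submodule.subset_span hsub)
    have h3 : B (r - p) p = 0 := by
      rw [LinearMap.map_sub₂, h.apply_self_of_isProj hp, h.symm, hpr.2, sub_self]
    refine eq_of_forall_apply_eq h.pos (W := ⊤) trivial trivial fun z _ => ?_
    have h4 : P z ∈ Submodule.span ℝ (S.projFace B p) := hprange ▸ ⟨z, rfl⟩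
    rw [map_zero, LinearMap.zero_apply, ← h2, hadj, ← h.proj_eq_self h4, ← h.proj_symm,
      h.proj_eq_zero hp hsub.1 h3, map_zero, LinearMap.zero_apply]
  obtain rfl := sub_eq_zero.1 hrp
  refine ⟨r, hr, LinearMap.ext fun x => ?_⟩
  -- The adjoint `P'` fixes the image of `P`, so `⟨P x, y⟩ = ⟨x, y⟩` for `y` in that image: `P` is
  -- orthogonal.
  refine eq_of_forall_apply_eq h.pos (hprange ▸ ⟨x, rfl⟩) (h.proj_mem_span r x) fun y hy => ?_
  rw [h.apply_proj_of_mem x hy, h.symm, ← hadj, hfix y (hrrange ▸ hy), h.symm]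

end IsSpectral

/-! ### Sums over pairs -/

/-- Each square `l_i²` occurs in `M - 1` pairs, so one copy survives the subtraction; the cross
terms occur once each. The coefficient `M - 2` is that of the interference formula. -/
theorem sum_pair_sq : ∀ {M : ℕ} (l : Fin M → ℝ),
    (∑ i, ∑ j ∈ Finset.Ioi i, (l i + l j) ^ 2) - ((M : ℝ) - 2) * ∑ i, l i ^ 2 = (∑ i, l i) ^ 2
  | 0, l => by simp
  | M + 1, l => by
    have ih := sum_pair_sq fun i : Fin M => l i.succ
    have h0 : ∑ j : Fin M, (l 0 + l j.succ) ^ 2 =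
        (M : ℝ) * l 0 ^ 2 + 2 * l 0 * ∑ j : Fin M, l j.succ + ∑ j : Fin M, l j.succ ^ 2 := by
      simp only [add_sq, Finset.sum_add_distrib, Finset.sum_const, Finset.card_univ,
        Fintype.card_fin, nsmul_eq_mul, Finset.mul_sum]
    simp only [Fin.sum_univ_succ, Fin.sum_Ioi_zero, Fin.sum_Ioi_succ, h0, Nat.cast_add,
      Nat.cast_one]
    linear_combination ih

theorem sum_pair_inter_sq {M : ℕ} (l : Fin M → ℝ) (J : Finset (Fin M)) :
    (∑ i, ∑ j ∈ Finset.Ioi i, (∑ k ∈ J ∩ {i, j}, l k) ^ 2) -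
      ((M : ℝ) - 2) * ∑ i, (∑ k ∈ J ∩ {i}, l k) ^ 2 = (∑ k ∈ J, l k) ^ 2 := by
  have key : ∀ K : Finset (Fin M), ∑ k ∈ J ∩ K, l k = ∑ k ∈ K, if k ∈ J then l k else 0 :=
    fun K => by rw [Finset.sum_ite_mem, Finset.inter_comm]
  have h1 := sum_pair_sq fun k => if k ∈ J then l k else 0
  rw [← key, Finset.inter_univ] at h1
  rw [← h1]
  simp only [key, Finset.sum_singleton]
  congr 1
  refine Finset.sum_congr rfl fun i _ => Finset.sum_congr rfl fun j hj => ?_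
  rw [Finset.sum_pair (Finset.mem_Ioi.1 hj).ne]

namespace IsSpectral

variable {S : OpSystem A} {B : LinearMap.BilinForm ℝ A} {I : A}

/-! ### Products of projections -/

theorem mem_projFace_add_left (h : S.IsSpectral B I) {p q : A} (hp : S.IsProj B p)
    (hpq : B p q = 0) : p ∈ S.projFace B (p + q) :=
  ⟨hp.mem_cone, by rw [map_add, hpq, add_zero, h.apply_self_of_isProj hp]⟩

/-- For a state `x` the vector obtained is positive, lies in the face of `b + a` and is orthogonal
to `a`, hence lies in the face of `b`. Pairings with the span of that face are unchanged by both
projections. -/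
theorem proj_add_proj_add (h : S.IsSpectral B I) {a b c : A} (ha : S.IsProj B a)
    (hb : S.IsProj B b) (hc : S.IsProj B c) (hab : B a b = 0) (hbc : B b c = 0)
    (hac : B a c = 0) (x : A) : h.proj (b + a) (h.proj (b + c) x) = h.proj b x := by
  have hba : B b a = 0 := by rw [h.symm, hab]
  have hpa := h.isProj_add hb ha hba
  have hpc := h.isProj_add hb hc hbc
  have hsub : ∀ {d}, S.IsProj B (b + d) → B b d = 0 → S.projFace B b ⊆ S.projFace B (b + d) :=
    fun hd hbd => h.projFace_subset hb (h.isFace_projFace hd) (h.mem_projFace_add_left hb hbd)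
  have hlin := S.linearMap_ext (f := h.proj (b + a) ∘ₗ h.proj (b + c)) (g := h.proj b)
    fun ω hω => ?_
  · exact DFunLike.congr_fun hlin x
  have hy := h.proj_mem_projFace hpc (S.mem_cone_of_mem_states hω)
  have hz := h.proj_mem_projFace hpa hy.1
  have hza : B (h.proj (b + a) (h.proj (b + c) ω)) a = 0 := by
    have ha' : a ∈ S.projFace B (b + a) := by
      rw [add_comm]
      exact h.mem_projFace_add_left ha hab
    rw [h.apply_proj_of_mem _ (Submodule.subset_span ha')]
    refine h.apply_eq_zero_of_mem_projFace hpc hy ha.mem_cone ?_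
    rw [map_add, hab, hac, add_zero]
  have hzb : h.proj (b + a) (h.proj (b + c) ω) ∈ S.projFace B b := by
    refine ⟨hz.1, ?_⟩
    rw [← hz.2, map_add, hza, add_zero]
  refine eq_of_forall_apply_eq h.pos (Submodule.subset_span hzb) (h.proj_mem_span b ω)
    fun w hw => ?_
  rw [LinearMap.comp_apply, h.apply_proj_of_mem _ (Submodule.span_mono (hsub hpa hba) hw),
    h.apply_proj_of_mem _ (Submodule.span_mono (hsub hpc hbc) hw), h.apply_proj_of_mem _ hw]

theorem apply_sum_sum_eq_zero {V : Type*} [AddCommGroup V] [Module ℝ V]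
    {B : LinearMap.BilinForm ℝ V} {ι : Type*} {p : ι → V}
    (ho : ∀ i j, i ≠ j → B (p i) (p j) = 0) {J K : Finset ι} (hJK : Disjoint J K) :
    B (∑ i ∈ J, p i) (∑ i ∈ K, p i) = 0 := by
  rw [map_sum]
  refine Finset.sum_eq_zero fun j hj => ?_
  rw [map_sum, LinearMap.sum_apply]
  exact Finset.sum_eq_zero fun i hi => ho i j (hJK.forall_ne_finset hi hj)

theorem proj_sum_proj_sum (h : S.IsSpectral B I) {ι : Type*} [DecidableEq ι] {p : ι → A}
    (hp : ∀ i, S.IsProj B (p i)) (ho : ∀ i j, i ≠ j → B (p i) (p j) = 0) (J K : Finset ι)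
    (x : A) : h.proj (∑ i ∈ J, p i) (h.proj (∑ i ∈ K, p i) x) = h.proj (∑ i ∈ J ∩ K, p i) x := by
  have hJ : ∑ i ∈ J, p i = ∑ i ∈ J ∩ K, p i + ∑ i ∈ J \ K, p i :=
    (Finset.sum_inter_add_sum_sdiff J K _).symm
  have hK : ∑ i ∈ K, p i = ∑ i ∈ J ∩ K, p i + ∑ i ∈ K \ J, p i := by
    rw [Finset.inter_comm]
    exact (Finset.sum_inter_add_sum_sdiff K J _).symm
  have hs := h.isProj_sum hp ho
  rw [hJ, hK]
  refine h.proj_add_proj_add (hs _) (hs _) (hs _) ?_ ?_ ?_ x <;>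
    refine apply_sum_sum_eq_zero ho (Finset.disjoint_left.2 fun i => ?_) <;> simp +contextual

/-- Since `⟨x, v⟩ = u x`, one has `‖x - u(x) v‖² = ‖x‖² - u(x)²`, which is at most `0` on the cone.
-/
theorem eq_smul_of_mem_projFace_pure (h : S.IsSpectral B I) {v x : A} (hv : S.IsPure v)
    (hx : x ∈ S.projFace B v) : x = S.unit x • v := by
  by_contra hne
  have := h.pos _ (sub_ne_zero.2 hne)
  simp only [map_sub, map_smul, LinearMap.sub_apply, LinearMap.smul_apply, smul_eq_mul,
    h.pure_self v hv, h.symm v x, hx.2] at this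
  linarith [h.apply_le_mul_unit hx.1 hx.1]

theorem proj_pure (h : S.IsSpectral B I) {v x : A} (hv : S.IsPure v) (hx : x ∈ S.cone) :
    h.proj v x = B x v • v := by
  have hp : S.IsProj B v := isProj_of_pure hv
  have := h.eq_smul_of_mem_projFace_pure hv (h.proj_mem_projFace hp hx)
  rwa [h.unit_proj hp] at this

theorem proj_one (h : S.IsSpectral B I) (x : A) : h.proj I x = x := by
  have hlin := S.linearMap_ext (f := h.proj I) (g := LinearMap.id) fun ω hω =>
    h.proj_eq_self (Submodule.subset_span ⟨S.mem_cone_of_mem_states hω, by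
      rw [h.symm, h.apply_one]⟩)
  exact DFunLike.congr_fun hlin x

/-! ### Slit experiments -/

/-- The vector representing `e` is in the cone and orthogonal to `I - p`, so it lies in the face of
`p`. Hence `e = e ∘ P_p`, and on the span of the face `e` agrees with `e₀`. -/
theorem effect_eq_proj (h : S.IsSpectral B I) {p : A} (hp : S.IsProj B p) {e e₀ : A →L[ℝ] ℝ}
    (he : S.IsEffect e) (h1 : ∀ ω ∈ S.projFace B p, e ω = e₀ ω)
    (h2 : ∀ φ ∈ S.complFace B (S.projFace B p), e φ = 0) (x : A) : e x = e₀ (h.proj p x) := by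
  obtain ⟨a, ha⟩ := exists_riesz h.pos e.toLinearMap
  have ha' : ∀ x, B a x = e x := ha
  have hac : a ∈ S.cone := (h.mem_cone_iff a).2 fun x hx => by
    rw [ha']
    exact S.effect_nonneg he hx
  have hap : a ∈ S.projFace B p := by
    refine ⟨hac, ?_⟩
    rw [h.complFace_projFace hp] at h2
    have := h2 _ (h.self_mem_projFace (h.isProj_compl hp))
    rw [← ha', map_sub, h.symm a I, h.apply_one] at this
    linarith
  have hspan : ∀ y ∈ Submodule.span ℝ (S.projFace B p), e y = e₀ y := fun y hy =>
    LinearMap.eqOn_span (f := e.toLinearMap) (g := e₀.toLinearMap) h1 hy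
  rw [← hspan _ (h.proj_mem_span p x), ← ha', ← ha', ← h.proj_symm,
    h.proj_eq_self (Submodule.subset_span hap)]

/-- If projections onto faces preserve purity, then the projection onto a join of orthogonal faces
is determined by the projections onto the joins of pairs. -/
theorem proj_sum_eq_of_preservesPurity (h : S.IsSpectral B I)
    (hpure : ∀ p, S.IsProj B p → S.PreservesPurity (h.proj p)) {M : ℕ} {p : Fin M → A}
    (hp : ∀ i, S.IsProj B (p i)) (ho : ∀ i j, i ≠ j → B (p i) (p j) = 0) (x : A) :
    h.proj (∑ i, p i) x = (∑ i, ∑ j ∈ Finset.Ioi i, h.proj (∑ k ∈ {i, j}, p k) x) -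
      ((M : ℝ) - 2) • ∑ i, h.proj (∑ k ∈ {i}, p k) x := by
  have hs := h.isProj_sum hp ho
  set PJ : Finset (Fin M) → A →ₗ[ℝ] A := fun J => h.proj (∑ k ∈ J, p k) with hPJ
  have hcomp : ∀ J K x, PJ J (PJ K x) = PJ (J ∩ K) x := h.proj_sum_proj_sum hp ho
  let R : A →ₗ[ℝ] A := (∑ i, ∑ j ∈ Finset.Ioi i, PJ {i, j}) - ((M : ℝ) - 2) • ∑ i, PJ {i}
  have hR : ∀ x, R x = (∑ i, ∑ j ∈ Finset.Ioi i, PJ {i, j} x) -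
      ((M : ℝ) - 2) • ∑ i, PJ {i} x := fun x => by
    simp [R, LinearMap.sum_apply]
  suffices hsuff : PJ Finset.univ = R by rw [← hR, ← hsuff]
  have hRP : ∀ x, R (PJ Finset.univ x) = R x := fun x => by simp [hR, hcomp]
  have hspanPure : ∀ f g : A →ₗ[ℝ] A, (∀ ω, S.IsPure ω → f ω = g ω) → f = g := by
    intro f g hfg
    refine S.linearMap_ext fun ω hω => ?_
    obtain ⟨s, l, hs, -, e⟩ := h.decomp ω (S.mem_cone_of_mem_states hω)
    rw [e, map_sum, map_sum]
    exact Finset.sum_congr rfl fun φ hφ => by rw [map_smul, map_smul, hfg φ (hs.1 φ hφ)]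
  have key : ∀ σ, S.IsPure σ → PJ Finset.univ σ = σ → R σ = σ := by
    intro σ hσ hfix
    -- Purity preservation enters here: `P_J σ = r τ` with `τ` pure, so its norm is `r`, which is
    -- also its value under `u`.
    have hnorm : ∀ J, B σ (PJ J σ) = (∑ k ∈ J, B σ (p k)) ^ 2 := by
      intro J
      have e1 : B σ (PJ J σ) = B (PJ J σ) (PJ J σ) := by
        rw [hPJ, h.proj_symm, h.proj_proj]
      have e2 : S.unit (PJ J σ) = ∑ k ∈ J, B σ (p k) := by
        rw [hPJ, h.unit_proj (hs J), map_sum]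
      obtain ⟨r, τ, -, hτ, e⟩ := hpure _ (hs J) σ hσ
      have e3 : PJ J σ = r • τ := e
      rw [e1, ← e2, e3]
      simp [h.pure_self τ hτ, hτ.unit_eq, sq]
    have hBR : ∀ J, B (PJ J σ) (R σ) = (∑ k ∈ J, B σ (p k)) ^ 2 := by
      intro J
      rw [← sum_pair_inter_sq]
      have : ∀ K, B (PJ J σ) (PJ K σ) = (∑ k ∈ J ∩ K, B σ (p k)) ^ 2 := fun K => by
        rw [← hnorm, ← hcomp, hPJ, h.proj_symm]
      simp only [hR, map_sub, map_sum, map_smul, this, smul_eq_mul]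
    have hone : ∑ k, B σ (p k) = 1 := by
      rw [← map_sum, ← h.unit_proj (hs _)]
      change S.unit (PJ Finset.univ σ) = 1
      rw [hfix, hσ.unit_eq]
    have h1 : B σ (R σ) = 1 := by
      have := hBR Finset.univ
      rwa [hfix, hone, one_pow] at this
    -- Expanding only the first `R σ` reduces this to the pairings `hBR`, and the quadratic identity
    -- applies once more. Then `‖Rσ - σ‖² = 1 - 2 + 1 = 0`.
    have h2 : B (R σ) (R σ) = 1 := by
      have : ∀ y, B (R σ) y = (∑ i, ∑ j ∈ Finset.Ioi i, B (PJ {i, j} σ) y) -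
          ((M : ℝ) - 2) * ∑ i, B (PJ {i} σ) y := fun y => by
        simp only [hR, map_sub, map_sum, map_smul, LinearMap.sub_apply, LinearMap.sum_apply,
          LinearMap.smul_apply, smul_eq_mul]
      rw [this]
      simp only [hBR]
      have := sum_pair_inter_sq (fun k => B σ (p k)) Finset.univ
      simpa [hone] using this
    by_contra hne
    have := h.pos _ (sub_ne_zero.2 hne)
    simp only [map_sub, LinearMap.sub_apply, h.symm (R σ) σ, h1, h2, h.pure_self σ hσ] at this
    linarith
  refine hspanPure _ _ fun ω hω => ?_
  obtain ⟨r, σ, hr, hσ, e⟩ := hpure _ (hs Finset.univ) ω hω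
  have e' : PJ Finset.univ ω = r • σ := e
  rw [← hRP, e']
  rcases eq_or_lt_of_le hr with h0 | h0
  · simp [← h0]
  · rw [map_smul, key σ hσ]
    have : PJ Finset.univ (r • σ) = r • σ := by rw [← e', hcomp, Finset.inter_univ]
    rw [map_smul] at this
    exact smul_right_injective A h0.ne' this

/-- Purity preserving filters exclude third-order interference. -/
theorem not_hasThirdOrderInterference (h : S.IsSpectral B I)
    (hpure : ∀ p, S.IsProj B p → S.PreservesPurity (h.proj p)) :
    ¬ S.HasThirdOrderInterference B := by
  rintro ⟨M, F, e, -, hexp, ω, -, hne⟩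
  choose p hp hF using fun j => h.exists_eq_projFace (hexp.face j)
  have ho : ∀ i j, i ≠ j → B (p i) (p j) = 0 := fun i j hij =>
    hexp.orthogonal i j hij _ (hF i ▸ h.self_mem_projFace (hp i)) _
      (hF j ▸ h.self_mem_projFace (hp j))
  have hF' : F = fun i => S.projFace B (p i) := funext hF
  obtain ⟨e₀, -, he₀⟩ := hexp.exists_effect
  have hJ : ∀ J, e J ω = e₀ (h.proj (∑ k ∈ J, p k) ω) := fun J => by
    obtain ⟨h1, h2⟩ := he₀ J
    rw [hF', h.faceJoin_projFace hp ho] at h1 h2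
    exact h.effect_eq_proj (h.isProj_sum hp ho J) (hexp.effect J) h1 h2 ω
  refine hne ?_
  simp only [hJ]
  rw [h.proj_sum_eq_of_preservesPurity hpure hp ho ω]
  simp only [map_sub, map_sum, map_smul, smul_eq_mul]

/-- Without third-order interference, pure states satisfy the pairwise decomposition for the
frames summing up to the unit. -/
theorem sum_pair_eq_one_of_not_interference (h : S.IsSpectral B I)
    (hni : ¬ S.HasThirdOrderInterference B) {M : ℕ} (hM : 3 ≤ M) {v : Fin M → A}
    (hv : ∀ i, S.IsPure (v i)) (ho : ∀ i j, i ≠ j → B (v i) (v j) = 0) (hI : ∑ i, v i = I)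
    {ω : A} (hω : S.IsPure ω) :
    (∑ i, ∑ j ∈ Finset.Ioi i, B ω (h.proj (v i + v j) ω)) -
      ((M : ℝ) - 2) * ∑ i, B ω (v i) ^ 2 = 1 := by
  have hp : ∀ i, S.IsProj B (v i) := fun i => isProj_of_pure (hv i)
  have hs := h.isProj_sum hp ho
  -- The experiment uses the effect represented by the tested state `ω` itself, preceded by the
  -- projection for the open slits.
  let e : Finset (Fin M) → (A →L[ℝ] ℝ) := fun J =>
    LinearMap.toContinuousLinearMap (B ω ∘ₗ h.proj (∑ k ∈ J, v k))
  have he : ∀ J x, e J x = B ω (h.proj (∑ k ∈ J, v k) x) := fun _ _ => rfl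
  have heff : ∀ J, S.IsEffect (e J) := fun J x hx => by
    have hxc := S.mem_cone_of_mem_states hx
    have hy := (h.proj_mem_projFace (hs J) hxc).1
    refine ⟨h.nonneg hω.mem_cone hy, ?_⟩
    exact (h.apply_le_unit_of_pure hω hy).trans
      ((h.unit_proj_le (hs J) hxc).trans_eq (S.unit_eq_one x hx))
  have hexp : S.IsSlitExperiment B (fun i => S.projFace B (v i)) e := by
    refine ⟨fun j => h.isFace_projFace (hp j), fun i j hij x hx y hy => ?_, heff,
      e Finset.univ, heff _, fun J => ?_⟩
    · refine h.apply_eq_zero_of_mem_projFace (hp i) hx hy.1 ?_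
      exact h.apply_eq_zero_of_mem_projFace (hp j) hy (hp i).mem_cone (ho i j hij)
    · rw [h.faceJoin_projFace hp ho, h.complFace_projFace (hs J)]
      refine ⟨fun x hx => ?_, fun x hx => ?_⟩
      · rw [he, he, hI, h.proj_one, h.proj_eq_self (Submodule.subset_span hx)]
      · rw [h.mem_projFace_compl] at hx
        rw [he, h.proj_eq_zero (hs J) hx.1 hx.2, map_zero]
  have key : e Finset.univ ω =
      (∑ i, ∑ j ∈ Finset.Ioi i, e {i, j} ω) - ((M : ℝ) - 2) * ∑ i, e {i} ω := by
    by_contra hne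
    exact hni ⟨M, _, e, hM, hexp, ω, hω.mem_states, hne⟩
  simp only [he, hI, h.proj_one, h.pure_self ω hω, Finset.sum_singleton,
    h.proj_pure (hv _) hω.mem_cone, map_smul, smul_eq_mul] at key
  rw [key]
  simp only [sq]
  congr 1
  exact Finset.sum_congr rfl fun i _ => Finset.sum_congr rfl fun j hj => by
    rw [Finset.sum_pair (Finset.mem_Ioi.1 hj).ne]

/-- Without third-order interference, the projection of a pure state onto a face has at most one
component along orthogonal pure states. -/
theorem mul_eq_zero_of_not_interference (h : S.IsSpectral B I)
    (hni : ¬ S.HasThirdOrderInterference B) {M : ℕ} (hM : 3 ≤ M) {v : Fin M → A}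
    (hv : ∀ i, S.IsPure (v i)) (ho : ∀ i j, i ≠ j → B (v i) (v j) = 0) (hI : ∑ i, v i = I)
    {ω : A} (hω : S.IsPure ω) {i j : Fin M} (hij : i < j)
    (hdiag : B ω (h.proj (v i + v j) ω) = B ω (v i) ^ 2 + B ω (v j) ^ 2) :
    B ω (v i) * B ω (v j) = 0 := by
  have h1 := h.sum_pair_eq_one_of_not_interference hni hM hv ho hI hω
  have h2 := sum_pair_sq fun k => B ω (v k)
  have hnn : ∀ k, 0 ≤ B ω (v k) := fun k => h.nonneg hω.mem_cone (hv k).mem_cone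
  rw [← map_sum, hI, h.symm, h.apply_one, hω.unit_eq, one_pow] at h2
  -- The defect `(u y)² - ‖y‖²` of `y = P_{km} ω` is nonnegative. The quadratic identity and the
  -- interference formula both evaluate to `1`, so all defects vanish. Under `hdiag` the defect for
  -- `i, j` is `2 ⟨ω, v i⟩ ⟨ω, v j⟩`.
  let d : Fin M → Fin M → ℝ := fun k m =>
    (B ω (v k) + B ω (v m)) ^ 2 - B ω (h.proj (v k + v m) ω)
  have hd : ∀ k, ∀ m ∈ Finset.Ioi k, 0 ≤ d k m := by
    intro k m hm
    have hkm := (Finset.mem_Ioi.1 hm).ne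
    have hp := h.isProj_add (isProj_of_pure (hv k)) (isProj_of_pure (hv m)) (ho k m hkm)
    have hy := (h.proj_mem_projFace hp hω.mem_cone).1
    have h3 := h.apply_le_mul_unit hy hy
    rw [h.unit_proj hp, map_add, h.proj_symm, h.proj_proj, ← sq] at h3
    exact sub_nonneg.2 h3
  have hsum : ∑ k, ∑ m ∈ Finset.Ioi k, d k m = 0 := by
    simp only [d, Finset.sum_sub_distrib]
    linarith
  have h3 : d i j ≤ ∑ k, ∑ m ∈ Finset.Ioi k, d k m :=
    (Finset.single_le_sum (hd i) (Finset.mem_Ioi.2 hij)).trans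
      (Finset.single_le_sum (f := fun k => ∑ m ∈ Finset.Ioi k, d k m)
        (fun k _ => Finset.sum_nonneg (hd k)) (Finset.mem_univ i))
  rw [hsum] at h3
  simp only [d, hdiag] at h3
  nlinarith [mul_nonneg (hnn i) (hnn j)]

/-- Without third-order interference, projections onto faces preserve purity. -/
theorem preservesPurity_proj (h : S.IsSpectral B I) (hni : ¬ S.HasThirdOrderInterference B)
    {p : A} (hp : S.IsProj B p) : S.PreservesPurity (h.proj p) := by
  classical
  intro ω hω
  obtain ⟨s, l, hs, hsp, hl, e⟩ := h.projFace_decomp hp (h.proj_mem_projFace hp hω.mem_cone)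
  have hlB : ∀ φ ∈ s, l φ = B ω φ := fun φ hφ => by
    rw [← h.apply_sum hs l hφ, ← e]
    exact h.apply_proj_of_mem ω (Submodule.subset_span (hsp ▸ h.mem_projFace_of_mem hs hφ))
  by_cases hzero : ∀ φ ∈ s, l φ = 0
  · refine ⟨0, ω, le_rfl, hω, ?_⟩
    rw [e, zero_smul]
    exact Finset.sum_eq_zero fun φ hφ => by rw [hzero φ hφ, zero_smul]
  push Not at hzero
  obtain ⟨φ, hφ, hφ0⟩ := hzero
  by_cases hone : ∀ ψ ∈ s, ψ ≠ φ → l ψ = 0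
  · refine ⟨l φ, φ, hl φ hφ, hs.1 φ hφ, ?_⟩
    rw [e]
    exact Finset.sum_eq_single φ (fun ψ hψ hne => by rw [hone ψ hψ hne, zero_smul])
      fun hn => absurd hφ hn
  push Not at hone
  obtain ⟨ψ, hψ, hne, hψ0⟩ := hone
  obtain ⟨t, hst, ht, hI⟩ := h.extend s hs
  -- If `s` already sums to `I`, the projection is the identity. Otherwise the completed family has
  -- a third member, as the bound `3 ≤ M` requires.
  by_cases hts : s = t
  · refine ⟨1, ω, zero_le_one, hω, ?_⟩
    rw [← hsp, hts, hI, h.proj_one, one_smul]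
  exfalso
  have hcard : 3 ≤ t.card := by
    have h2 : ({φ, ψ} : Finset A) ⊆ s := by
      intro x hx
      rcases Finset.mem_insert.1 hx with rfl | hx
      · exact hφ
      · exact Finset.mem_singleton.1 hx ▸ hψ
    have h3 := Finset.card_le_card h2
    rw [Finset.card_pair hne.symm] at h3
    have h4 := Finset.card_lt_card (hst.ssubset_of_ne hts)
    omega
  let v : Fin t.card → A := fun i => (t.equivFin.symm i : A)
  have hv : ∀ i, S.IsPure (v i) := fun i => ht.1 _ (t.equivFin.symm i).2
  have ho : ∀ i j, i ≠ j → B (v i) (v j) = 0 := fun i j hij =>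
    ht.2 _ (t.equivFin.symm i).2 _ (t.equivFin.symm j).2 fun h0 =>
      hij (t.equivFin.symm.injective (Subtype.ext h0))
  have hvI : ∑ i, v i = I := by
    rw [← hI, ← Finset.sum_coe_sort t]
    exact Equiv.sum_comp t.equivFin.symm fun x : t => (x : A)
  have hvs : ∀ x ∈ t, ∃ i, v i = x := fun x hx => ⟨t.equivFin ⟨x, hx⟩, by simp [v]⟩
  -- The family diagonalizes `P_p ω`, so projecting further onto a pair keeps just two orthogonal
  -- components and no cross term.
  have hproj : ∀ α ∈ s, ∀ β ∈ s, α ≠ β →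
      B ω (h.proj (α + β) ω) = B ω α ^ 2 + B ω β ^ 2 := by
    intro α hα β hβ hαβ
    have hpair : S.IsProj B (α + β) :=
      h.isProj_add (isProj_of_pure (hs.1 α hα)) (isProj_of_pure (hs.1 β hβ)) (hs.2 α hα β hβ hαβ)
    have hsubset : S.projFace B (α + β) ⊆ S.projFace B p := by
      refine h.projFace_subset hpair (h.isFace_projFace hp) (add_mem_projFace ?_ ?_) <;>
        rw [← hsp]
      exacts [h.mem_projFace_of_mem hs hα, h.mem_projFace_of_mem hs hβ]
    have h1 : B ω (h.proj (α + β) ω) = B (h.proj p ω) (h.proj (α + β) (h.proj p ω)) := by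
      have h2 : h.proj (α + β) (h.proj p ω) = h.proj (α + β) ω :=
        eq_of_forall_apply_eq h.pos (h.proj_mem_span _ _) (h.proj_mem_span _ _) fun z hz => by
          rw [h.apply_proj_of_mem _ hz, h.apply_proj_of_mem _ hz,
            h.apply_proj_of_mem _ (Submodule.span_mono hsubset hz)]
      rw [h2, h.apply_proj_of_mem ω (Submodule.span_mono hsubset (h.proj_mem_span _ _))]
    have h3 : h.proj (α + β) (h.proj p ω) = l α • α + l β • β := by
      have hfix : ∀ γ ∈ s, γ ∈ ({α, β} : Finset A) → h.proj (α + β) γ = γ := by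
        intro γ hγ hmem
        refine h.proj_eq_self (Submodule.subset_span ⟨(hs.1 γ hγ).mem_cone, ?_⟩)
        rw [map_add, (hs.1 γ hγ).unit_eq]
        rcases Finset.mem_insert.1 hmem with rfl | hm
        · rw [h.pure_self γ (hs.1 γ hγ), hs.2 γ hγ β hβ hαβ, add_zero]
        · obtain rfl := Finset.mem_singleton.1 hm
          rw [h.pure_self γ (hs.1 γ hγ), hs.2 γ hγ α hα hαβ.symm, zero_add]
      have hkill : ∀ γ ∈ s, γ ∉ ({α, β} : Finset A) → h.proj (α + β) γ = 0 := by
        intro γ hγ hmem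
        simp only [Finset.mem_insert, Finset.mem_singleton, not_or] at hmem
        refine h.proj_eq_zero hpair (hs.1 γ hγ).mem_cone ?_
        rw [map_add, hs.2 γ hγ α hα hmem.1, hs.2 γ hγ β hβ hmem.2, add_zero]
      have hsub : ({α, β} : Finset A) ⊆ s := by
        intro x hx
        rcases Finset.mem_insert.1 hx with rfl | hx
        · exact hα
        · exact Finset.mem_singleton.1 hx ▸ hβ
      rw [e, map_sum, ← Finset.sum_subset hsub fun γ hγ hn => by
        rw [map_smul, hkill γ hγ hn, smul_zero], Finset.sum_pair hαβ, map_smul, map_smul,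
        hfix α hα (by simp), hfix β hβ (by simp)]
    rw [h1, h3, map_add, map_smul, map_smul, e, h.apply_sum hs l hα, h.apply_sum hs l hβ,
      ← hlB α hα, ← hlB β hβ, sq, sq, smul_eq_mul, smul_eq_mul]
  obtain ⟨i, hi⟩ := hvs φ (hst hφ)
  obtain ⟨j, hj⟩ := hvs ψ (hst hψ)
  rw [hlB φ hφ, ← hi] at hφ0
  rw [hlB ψ hψ, ← hj] at hψ0
  have hmul : B ω (v i) * B ω (v j) = 0 := by
    rcases lt_trichotomy i j with hij | rfl | hij
    · exact h.mul_eq_zero_of_not_interference hni hcard hv ho hvI hω hij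
        (by rw [hi, hj]; exact hproj φ hφ ψ hψ hne.symm)
    · exact absurd (hj.symm.trans hi) hne
    · rw [mul_comm]
      exact h.mul_eq_zero_of_not_interference hni hcard hv ho hvI hω hij
        (by rw [hi, hj]; exact hproj ψ hψ φ hφ hne)
  exact mul_ne_zero hφ0 hψ0 hmul

theorem not_hasThirdOrderInterference_iff (h : S.IsSpectral B I) :
    ¬ S.HasThirdOrderInterference B ↔
      ∀ P : A →ₗ[ℝ] A, S.IsFilter P → S.PreservesPurity P := by
  constructor
  · intro hni P hP
    obtain ⟨p, hp, rfl⟩ := h.exists_eq_proj_of_isFilter hP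
    exact h.preservesPurity_proj hni hp
  · exact fun hP => h.not_hasThirdOrderInterference fun p hp => hP _ (h.isFilter_proj hp)

end IsSpectral

end OpSystem
end OPT

/-! ### The proposition -/

theorem mainTheorem4 {A : Type*} [NormedAddCommGroup A] [NormedSpace ℝ A]
    [FiniteDimensional ℝ A] (S : OPT.OpSystem A) (h1 : S.Postulate1) (h2 : S.Postulate2) :
    (∃ B : LinearMap.BilinForm ℝ A, S.IsSelfDualizing B) ∧
    ∀ B : LinearMap.BilinForm ℝ A, S.IsSelfDualizing B →
      (¬ S.HasThirdOrderInterference B ↔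
        ∀ P : A →ₗ[ℝ] A, S.IsFilter P → S.PreservesPurity P) := by
  refine ⟨OPT.OpSystem.exists_isSelfDualizing h1 h2, fun B hB => ?_⟩
  obtain ⟨I, hI⟩ := hB.exists_isSpectral h1 h2
  exact hI.not_hasThirdOrderInterference_iff
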